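/- Let $n\ge 1$, let $a,b,c,d,z$ and $x_1,\dots,x_n$ be commuting indeterminates and $X_n=(x_1,\dots,x_n)$. The Pfaffian of a skew-symmetric matrix $(a_{ij})$ of size $2m$ is $\sum \epsilon(\sigma)\,a_{\sigma_1\sigma_2}\cdots a_{\sigma_{2m-1}\sigma_{2m}}$, summed over the perfect matchings $\{\{\sigma_1<\sigma_2\},\dots,\{\sigma_{2m-1}<\sigma_{2m}\}\}$ of the index set, with $\epsilon(\sigma)$ the sign of the permutation $(\sigma_1,\dots,\sigma_{2m})$. For a strict partition $\mu=(\mu_1>\dots>\mu_l>0)$ put $\ell(\mu)=l$, $\mu_i=0$ for $i>l$, and $$\omega(\mu)=a^{\sum_{i\ge1}\lceil\mu_{2i-1}/2\rceil}\,b^{\sum_{i\ge1}\lfloor\mu_{2i-1}/2\rfloor}\,c^{\sum_{i\ge1}\lceil\mu_{2i}/2\rceil}\,d^{\sum_{i\ge1}\lfloor\mu_{2i}/2\rfloor}.$$ Let $A_\mu(x_1,\dots,x_n)$ be the skew-symmetric matrix $\begin{pmatrix}A_n&G\\-{}^tG&O_l\end{pmatrix}$ of size $n+l$, where $A_n=\left(\frac{x_i-x_j}{x_i+x_j}\right)_{1\le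 i,j\le n}$ (with zero diagonal) and $G=\left(x_i^{\mu_{l+1-j}}\right)_{1\le i\le n,\,1\le j\le l}$. Let $\operatorname{Pf}_\mu(X_n)$ be $\operatorname{Pf}A_\mu(x_1,\dots,x_n)$ if $n+l$ is even and $\operatorname{Pf}A_\mu(x_1,\dots,x_n,0)$ if $n+l$ is odd. Schur's $P$-function is $P_\mu(X_n)=\operatorname{Pf}_\mu(X_n)/\operatorname{Pf}_\emptyset(X_n)$ (which is $0$ for $l>n$). Work in the ring $\mathbb{Q}(x_1,\dots,x_n)[[a,b,c,d,z]]$ of formal power series, with coefficientwise convergence. Put $$\zeta_N(a,b,c,d;z;X_n)=\sum_{\mu_1\le N}\omega(\mu)z^{\ell(\mu)}P_\mu(X_n),\qquad \zeta(a,b,c,d;z;X_n)=\sum_{\mu}\omega(\mu)z^{\ell(\mu)}P_\mu(X_n),$$ the sums being over the strict partitions $\mu$ with all parts at most $N$, respectively over all strict partitions, and $\xi(a,b,c,d;X_n)=\zeta(a,b,c,d;1;X_n)$. Theorem. The series defining $\zeta(a,b,c,d;z;X_n)$ and $\xi(a,b,c,d;X_n)$ converge and are the limits for $N\to\infty$ of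 $\zeta_N(a,b,c,d;z;X_n)$ and $\zeta_N(a,b,c,d;1;X_n)$. Moreover $$\zeta(a,b,c,d;z;X_n)=\begin{cases}\operatorname{Pf}(\gamma_{ij})_{1\le i<j\le n}/\operatorname{Pf}_\emptyset(X_n)&\text{if $n$ is even,}\\ \operatorname{Pf}(\gamma_{ij})_{0\le i<j\le n}/\operatorname{Pf}_\emptyset(X_n)&\text{if $n$ is odd,}\end{cases}$$ where the matrices are the skew-symmetric ones with the indicated upper triangular entries, $\gamma_{ij}=\frac{x_i-x_j}{x_i+x_j}+u_{ij}z+v_{ij}z^2$ for $1\le i<j\le n$ with $$u_{ij}=\frac{a\det\begin{pmatrix}x_i+bx_i^2&1-abx_i^2\\x_j+bx_j^2&1-abx_j^2\end{pmatrix}}{(1-abx_i^2)(1-abx_j^2)},$$ $$v_{ij}=\frac{abc\,x_ix_j\det\begin{pmatrix}x_i+ax_i^2&1-a(b+d)x_i^2-abdx_i^3\\x_j+ax_j^2&1-a(b+d)x_j^2-abdx_j^3\end{pmatrix}}{(1-abx_i^2)(1-abx_j^2)(1-abcdx_i^2x_j^2)},$$ and $\gamma_{0j}=1+\frac{ax_j(1+bx_j)}{1-abx_j^2}z$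 for $1\le j\le n$. (The rational functions are read as power series in $a,b,c,d$.) For $z=1$, $$\xi(a,b,c,d;X_n)=\begin{cases}\operatorname{Pf}(\widetilde\gamma_{ij})_{1\le i<j\le n}/\operatorname{Pf}_\emptyset(X_n)&\text{if $n$ is even,}\\ \operatorname{Pf}(\widetilde\gamma_{ij})_{0\le i<j\le n}/\operatorname{Pf}_\emptyset(X_n)&\text{if $n$ is odd,}\end{cases}$$ where $\widetilde\gamma_{0j}=\frac{1+ax_j}{1-abx_j^2}$ for $1\le j\le n$, and $\widetilde\gamma_{ij}=\frac{x_i-x_j}{x_i+x_j}+\widetilde v_{ij}$ for $1\le i<j\le n$ with $$\widetilde v_{ij}=\frac{a\det\begin{pmatrix}x_i+bx_i^2&1-b(a+c)x_i^2-abcx_i^3\\x_j+bx_j^2&1-b(a+c)x_j^2-abcx_j^3\end{pmatrix}}{(1-abx_i^2)(1-abx_j^2)(1-abcdx_i^2x_j^2)}.$$ -/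

import Mathlib

open scoped MvPowerSeries.WithPiTopology

noncomputable section

namespace SchurP

/-- The Pfaffian of a (skew-symmetric) matrix `A` of even size `m = 2k`: the sum over all perfect
matchings `{{σ₁, σ₂}, …, {σ₂ₖ₋₁, σ₂ₖ}}` of the index set, of the sign of the permutation
`(σ₁, …, σ₂ₖ)` times `A σ₁ σ₂ * ⋯ * A σ₂ₖ₋₁ σ₂ₖ`. A perfect matching is represented by the unique
permutation `σ` that lists the smaller element of each block first, and the blocks in increasing
order of their smaller elements. In odd size the value is `0` by convention. -/
def pfaffian {R : Type*} [CommRing R] {m : ℕ} (A : Matrix (Fin m) (Fin m) R) : R :=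
  open Classical in
  if Even m then
    ∑ σ : Equiv.Perm (Fin m) with
        (∀ i : Fin (m / 2), σ ⟨2 * i, by omega⟩ < σ ⟨2 * i + 1, by omega⟩) ∧
        (∀ i j : Fin (m / 2), i < j → σ ⟨2 * i, by omega⟩ < σ ⟨2 * j, by omega⟩),
      ((Equiv.Perm.sign σ : ℤ) : R) *
        ∏ i : Fin (m / 2), A (σ ⟨2 * i, by omega⟩) (σ ⟨2 * i + 1, by omega⟩)
  else 0

/-- A strict partition `μ₁ > μ₂ > ⋯ > μ_l > 0`, as the list of its parts. -/
@[ext]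
structure StrictPartition where
  parts : List ℕ
  decreasing : parts.Pairwise (· > ·)
  pos : ∀ p ∈ parts, 0 < p

namespace StrictPartition

/-- The number of (nonzero) parts. -/
def length (μ : StrictPartition) : ℕ := μ.parts.length

/-- The empty partition. -/
def empty : StrictPartition := ⟨[], List.Pairwise.nil, by simp⟩

/-- The parts with zeros appended, numbered from `0`: `μ.part i` is `μ_{i+1}`. -/
def part (μ : StrictPartition) (i : ℕ) : ℕ := μ.parts.getD i 0

theorem finite_bounded (N : ℕ) : {μ : StrictPartition | ∀ p ∈ μ.parts, p ≤ N}.Finite := by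
  have hinj : Function.Injective (fun μ : StrictPartition => μ.parts.toFinset) := by
    intro μ ν h
    have hn : ∀ κ : StrictPartition, κ.parts.Nodup := fun κ =>
      κ.decreasing.imp (fun hab => (Nat.ne_of_lt hab).symm)
    have hp : μ.parts.Perm ν.parts := by
      rw [List.perm_ext_iff_of_nodup (hn μ) (hn ν)]
      intro a
      have := congrArg (fun s => a ∈ s) h
      simpa using this
    ext1
    exact hp.eq_of_pairwise (fun a b _ _ h1 h2 => absurd h1 (Nat.lt_asymm h2))
      μ.decreasing ν.decreasing
  refine Set.Finite.of_finite_image (f := fun μ : StrictPartition => μ.parts.toFinset) ?_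
    hinj.injOn
  refine (Finset.finite_toSet (Finset.range (N + 1)).powerset).subset ?_
  rintro _ ⟨μ, hμ, rfl⟩
  simp only [Finset.coe_powerset, Set.mem_preimage, Set.mem_powerset_iff]
  intro p hp
  simp only [List.coe_toFinset, Set.mem_ofPred_eq] at hp
  simpa [Nat.lt_succ_iff] using hμ p hp

/-- The finite set of all strict partitions with every part at most `N`. -/
def bounded (N : ℕ) : Finset StrictPartition := (finite_bounded N).toFinset

/-- The four parameter weight `ω(μ)`; in `part`, the index `i` is even exactly for the
odd-numbered parts `μ₁, μ₃, …`, and `(p + 1) / 2`, `p / 2` are `⌈p/2⌉`, `⌊p/2⌋`. -/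
def weight {R : Type*} [CommRing R] (a b c d : R) (μ : StrictPartition) : R :=
  a ^ (∑ i ∈ Finset.range μ.length with Even i, (μ.part i + 1) / 2) *
  b ^ (∑ i ∈ Finset.range μ.length with Even i, μ.part i / 2) *
  c ^ (∑ i ∈ Finset.range μ.length with Odd i, (μ.part i + 1) / 2) *
  d ^ (∑ i ∈ Finset.range μ.length with Odd i, μ.part i / 2)

end StrictPartition

section SchurPFunctions

variable {K : Type*} [Field K] {n : ℕ}

/-- The skew-symmetric matrix `A_n = ((x_i - x_j) / (x_i + x_j))`; its diagonal is `0`. -/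
def schurMatrix (x : Fin n → K) : Matrix (Fin n) (Fin n) K :=
  Matrix.of fun i j => if i = j then 0 else (x i - x j) / (x i + x j)

/-- The `n × l` matrix `Γ_μ J_l`, with entries `x_i ^ μ_j`, columns in reversed order. -/
def powerMatrix (x : Fin n → K) (μ : StrictPartition) : Matrix (Fin n) (Fin μ.length) K :=
  Matrix.of fun i j => x i ^ μ.part (Fin.rev j)

/-- The skew-symmetric matrix `A_μ(x_1, …, x_n)` of size `n + l`. -/
def blockMatrix (x : Fin n → K) (μ : StrictPartition) :
    Matrix (Fin (n + μ.length)) (Fin (n + μ.length)) K :=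
  (Matrix.fromBlocks (schurMatrix x) (powerMatrix x μ) (-(powerMatrix x μ).transpose) 0).submatrix
    finSumFinEquiv.symm finSumFinEquiv.symm

/-- `Pf_μ(x_1, …, x_n)`: the Pfaffian of `A_μ(x_1, …, x_n)` if `n + l` is even, and of
`A_μ(x_1, …, x_n, 0)` if `n + l` is odd. -/
def pfMu (x : Fin n → K) (μ : StrictPartition) : K :=
  if Even (n + μ.length) then pfaffian (blockMatrix x μ)
  else pfaffian (blockMatrix (Fin.snoc x 0 : Fin (n + 1) → K) μ)

/-- Schur's `P`-function `P_μ(x_1, …, x_n) = Pf_μ / Pf_∅`. For `l > n` this is `0`, as usual, since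
then the matrix defining `Pf_μ` is singular. -/
def schurP (x : Fin n → K) (μ : StrictPartition) : K :=
  pfMu x μ / pfMu x StrictPartition.empty

end SchurPFunctions

section Zeta

variable {σ K : Type*} [Field K] {n : ℕ}

/-- The term `ω(μ) z^{ℓ(μ)} P_μ(X_n)`, a power series with coefficients in a field `K` that
contains `x_1, …, x_n`. -/
def zetaTerm (a b c d z : MvPowerSeries σ K) (x : Fin n → K) (μ : StrictPartition) :
    MvPowerSeries σ K :=
  μ.weight a b c d * z ^ μ.length * MvPowerSeries.C (schurP x μ)

/-- `ζ_N(a, b, c, d; z; X_n)`, the sum over the strict partitions with all parts at most `N`. -/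
def zetaN (a b c d z : MvPowerSeries σ K) (x : Fin n → K) (N : ℕ) : MvPowerSeries σ K :=
  ∑ μ ∈ StrictPartition.bounded N, zetaTerm a b c d z x μ

/-- `ζ(a, b, c, d; z; X_n)`, the sum over all strict partitions. -/
def zeta [TopologicalSpace K] (a b c d z : MvPowerSeries σ K) (x : Fin n → K) :
    MvPowerSeries σ K :=
  ∑' μ : StrictPartition, zetaTerm a b c d z x μ

/-- `ξ(a, b, c, d; X_n) = ζ(a, b, c, d; 1; X_n)`. -/
def xi [TopologicalSpace K] (a b c d : MvPowerSeries σ K) (x : Fin n → K) : MvPowerSeries σ K :=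
  zeta a b c d 1 x

end Zeta

section Entries

/-! The entries of the Pfaffians, for power series `a, b, c, d, z, x_1, …, x_n` over a field;
`f⁻¹` is the inverse of a power series `f` with nonzero constant coefficient. -/

variable {σ K : Type*} [Field K] {n : ℕ} (a b c d z : MvPowerSeries σ K)
  (x : Fin n → MvPowerSeries σ K)

/-- `u_{ij}` -/
def uEntry (i j : Fin n) : MvPowerSeries σ K :=
  a * Matrix.det !![x i + b * x i ^ 2, 1 - a * b * x i ^ 2;
                    x j + b * x j ^ 2, 1 - a * b * x j ^ 2] *
    ((1 - a * b * x i ^ 2) * (1 - a * b * x j ^ 2))⁻¹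

/-- `v_{ij}` -/
def vEntry (i j : Fin n) : MvPowerSeries σ K :=
  a * b * c * x i * x j *
    Matrix.det
      !![x i + a * x i ^ 2, 1 - a * (b + d) * x i ^ 2 - a * b * d * x i ^ 3;
         x j + a * x j ^ 2, 1 - a * (b + d) * x j ^ 2 - a * b * d * x j ^ 3] *
    ((1 - a * b * x i ^ 2) * (1 - a * b * x j ^ 2) *
      (1 - a * b * c * d * x i ^ 2 * x j ^ 2))⁻¹

/-- `ṽ_{ij}` -/
def vTildeEntry (i j : Fin n) : MvPowerSeries σ K :=
  a *
    Matrix.det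
      !![x i + b * x i ^ 2, 1 - b * (a + c) * x i ^ 2 - a * b * c * x i ^ 3;
         x j + b * x j ^ 2, 1 - b * (a + c) * x j ^ 2 - a * b * c * x j ^ 3] *
    ((1 - a * b * x i ^ 2) * (1 - a * b * x j ^ 2) *
      (1 - a * b * c * d * x i ^ 2 * x j ^ 2))⁻¹

/-- `γ_{ij}` for `1 ≤ i, j ≤ n`; it is `0` for `i = j`. -/
def gamma : Matrix (Fin n) (Fin n) (MvPowerSeries σ K) :=
  Matrix.of fun i j => if i = j then 0 else
    (x i - x j) * (x i + x j)⁻¹ + uEntry a b x i j * z + vEntry a b c d x i j * z ^ 2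

/-- `γ_{0j}` for `1 ≤ j ≤ n` -/
def gammaZero (j : Fin n) : MvPowerSeries σ K :=
  1 + a * x j * (1 + b * x j) * (1 - a * b * x j ^ 2)⁻¹ * z

/-- `γ̃_{ij}` for `1 ≤ i, j ≤ n`; it is `0` for `i = j`. -/
def gammaTilde : Matrix (Fin n) (Fin n) (MvPowerSeries σ K) :=
  Matrix.of fun i j => if i = j then 0 else
    (x i - x j) * (x i + x j)⁻¹ + vTildeEntry a b c d x i j

/-- `γ̃_{0j}` for `1 ≤ j ≤ n` -/
def gammaTildeZero (j : Fin n) : MvPowerSeries σ K :=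
  (1 + a * x j) * (1 - a * b * x j ^ 2)⁻¹

end Entries

/-- The matrix of size `n + 1` obtained from the `n × n` matrix `A` by adding, in front, the row
`(0, r_1, …, r_n)` and the column `(0, -r_1, …, -r_n)`. -/
def bordered {R : Type*} [CommRing R] {n : ℕ} (r : Fin n → R) (A : Matrix (Fin n) (Fin n) R) :
    Matrix (Fin (n + 1)) (Fin (n + 1)) R :=
  Matrix.of fun i j =>
    Fin.cases (Fin.cases 0 (fun j' => r j') j)
      (fun i' => Fin.cases (-r i') (fun j' => A i' j') j) i

/-- The field `ℚ(x_1, …, x_n)` of rational functions. -/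
def RatFun (n : ℕ) : Type := FractionRing (MvPolynomial (Fin n) ℚ)

instance instFieldRatFun (n : ℕ) : Field (RatFun n) :=
  inferInstanceAs (Field (FractionRing (MvPolynomial (Fin n) ℚ)))

instance instAlgebraRatFun (n : ℕ) : Algebra (MvPolynomial (Fin n) ℚ) (RatFun n) :=
  inferInstanceAs (Algebra (MvPolynomial (Fin n) ℚ) (FractionRing (MvPolynomial (Fin n) ℚ)))

instance instIsFractionRingRatFun (n : ℕ) : IsFractionRing (MvPolynomial (Fin n) ℚ) (RatFun n) :=
  inferInstanceAs (IsFractionRing (MvPolynomial (Fin n) ℚ) (FractionRing (MvPolynomial (Fin n) ℚ)))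

/-- The coefficient field is discrete, so that convergence of formal power series (in the
topology of coefficientwise convergence) means that every coefficient is eventually constant. -/
instance instTopologicalSpaceRatFun (n : ℕ) : TopologicalSpace (RatFun n) := ⊥

instance instDiscreteTopologyRatFun (n : ℕ) : DiscreteTopology (RatFun n) := ⟨rfl⟩

/-- The indeterminates `x_1, …, x_n` (numbered from `0`) in `ℚ(x_1, …, x_n)`. -/
def xvar (n : ℕ) (i : Fin n) : RatFun n :=
  algebraMap (MvPolynomial (Fin n) ℚ) (RatFun n) (MvPolynomial.X i)

/-- The ring `ℚ(x_1, …, x_n)[[a, b, c, d, z]]`; the indeterminates `a, b, c, d, z` are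
`X 0, X 1, X 2, X 3, X 4`. -/
abbrev Series (n : ℕ) : Type := MvPowerSeries (Fin 5) (RatFun n)

/-- The indeterminates `x_1, …, x_n` as elements of the power series ring. -/
def xser (n : ℕ) (i : Fin n) : Series n := MvPowerSeries.C (xvar n i)

/-- `Pf_∅(X_n)` as an element of the power series ring. -/
def pfEmpty (n : ℕ) : Series n := MvPowerSeries.C (pfMu (xvar n) StrictPartition.empty)

end SchurP

end

/-! The Pfaffian of a Gram matrix is a linear functional on an exterior algebra. For an alternating
form `B`, let `exp(B)` be the exponential of the contraction by `B`. The functional Pf_B that takes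
the scalar part of `exp(B) x` sends v_1 ∧ ... ∧ v_m to the Pfaffian of (B(v_i, v_j)), since both
obey the expansion along the first row (`pfaffianForm_ιMulti`).

Take vectors e_1, ..., e_n, f_0, f_1, ... with B(e_i, e_j) = (x_i - x_j)/(x_i + x_j), B(e_i, f_p) =
x_i^p and B(f_p, f_q) = 0. Then Pf_μ is the value of Pf_B on the product of the e_i followed by the
f_p for the parts p of μ, together with f_0 when a parity correction is needed. Under Pf_B, right
multiplication by f_p amounts to contraction by v_p = B(·, f_p), so Pf_μ is Pf_B of a product of
contractions applied to e_1 ∧ ... ∧ e_n (`map_pfMu`).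

Let α and β be the weights of parts in odd and even positions, with α_0 = β_0 = 1. Summed over the
strict partitions with parts at most N, the weighted products of contractions equal exp(ω) with ω =
∑_{q<p≤N} α_p β_q v_p ∧ v_q, followed in odd parity by the extra contraction by ∑ α_p v_p
(`partitionOperator_eq`). This goes by induction on N: a new largest part exchanges α and β, and
anticommutation of contractions does the rest. Since exp(B) exp(ω) = exp(B + ω), the finite sum is
the Pfaffian with entries (B + ω)(e_i, e_j), bordered when n is odd
(`sum_bounded_alternatingWeight_mul_pfMu`).

For the given weights these entries are geometric sums. For N = 2k they differ from a fixed rational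
function by a multiple of (a b x_i^2)^k or (a b x_j^2)^k, which tends to 0 coefficientwise, and the
Pfaffian is continuous in its entries (`zeta_eq`). The case z = 1 then needs only u_ij + v_ij =
ṽ_ij. -/

namespace SchurP

/-! ### Expansion of the Pfaffian along the first row. -/

section PfaffianExpansion

variable {R : Type*} [CommRing R]

/-- The permutations that list a perfect matching in normal form. -/
def IsMatchingPerm {k : ℕ} (σ : Equiv.Perm (Fin (2 * k))) : Prop :=
  (∀ i : Fin k, σ ⟨2 * i, by omega⟩ < σ ⟨2 * i + 1, by omega⟩) ∧
    ∀ i j : Fin k, i < j → σ ⟨2 * i, by omega⟩ < σ ⟨2 * j, by omega⟩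

open Classical in
theorem pfaffian_two_mul {k : ℕ} (A : Matrix (Fin (2 * k)) (Fin (2 * k)) R) :
    pfaffian A = ∑ σ : Equiv.Perm (Fin (2 * k)) with IsMatchingPerm σ,
      ((Equiv.Perm.sign σ : ℤ) : R) *
        ∏ i : Fin k, A (σ ⟨2 * i, by omega⟩) (σ ⟨2 * i + 1, by omega⟩) := by
  have hk : 2 * k / 2 = k := by omega
  rw [pfaffian, if_pos (even_two_mul k)]
  refine Finset.sum_congr ?_ ?_
  · ext σ
    simp only [Finset.mem_filter, Finset.mem_univ, true_and]
    constructor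
    · rintro ⟨h1, h2⟩
      exact ⟨fun i => h1 ⟨i, by omega⟩,
        fun i j hij => h2 ⟨i, by omega⟩ ⟨j, by omega⟩ hij⟩
    · rintro ⟨h1, h2⟩
      exact ⟨fun i => h1 ⟨i, by omega⟩,
        fun i j hij => h2 ⟨i, by omega⟩ ⟨j, by omega⟩ hij⟩
  · intro σ _
    congr 1
    exact Fintype.prod_equiv (finCongr hk) _ _ fun i => rfl

theorem pfaffian_of_not_even {m : ℕ} (hm : ¬ Even m) (A : Matrix (Fin m) (Fin m) R) :
    pfaffian A = 0 := by
  rw [pfaffian, if_neg hm]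

theorem pfaffian_fin_zero (A : Matrix (Fin 0) (Fin 0) R) : pfaffian A = 1 := by
  have h := pfaffian_two_mul (k := 0) A
  rw [h, Finset.sum_eq_single_of_mem (1 : Equiv.Perm (Fin (2 * 0)))]
  · simp
  · simp [IsMatchingPerm]
  · intro σ _ hσ
    exact absurd (Equiv.ext fun i => i.elim0) hσ

/-- The permutation of `Fin (m + 2)` with values `0, j + 1` followed by the values of `τ` in the
complement. -/
def insertPair {m : ℕ} (j : Fin (m + 1)) (τ : Equiv.Perm (Fin m)) : Equiv.Perm (Fin (m + 2)) :=
  Equiv.Perm.decomposeFin.symm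
    (0, j.cycleRange.symm * Equiv.Perm.decomposeFin.symm (0, τ))

theorem insertPair_zero {m : ℕ} (j : Fin (m + 1)) (τ : Equiv.Perm (Fin m)) :
    insertPair j τ 0 = 0 := by
  simp [insertPair]

theorem insertPair_one {m : ℕ} (j : Fin (m + 1)) (τ : Equiv.Perm (Fin m)) :
    insertPair j τ 1 = j.succ := by
  have : (1 : Fin (m + 2)) = Fin.succ 0 := rfl
  rw [insertPair, this, Equiv.Perm.decomposeFin_symm_apply_succ]
  simp

theorem insertPair_succ_succ {m : ℕ} (j : Fin (m + 1)) (τ : Equiv.Perm (Fin m)) (i : Fin m) :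
    insertPair j τ i.succ.succ = (j.succAbove (τ i)).succ := by
  rw [insertPair, Equiv.Perm.decomposeFin_symm_apply_succ]
  simp [Fin.cycleRange_symm_succ]

/-- The factor `j.cycleRange` is a cycle of length j + 1, and extending a permutation by a fixed
point 0 keeps its sign. -/
theorem sign_insertPair {m : ℕ} (j : Fin (m + 1)) (τ : Equiv.Perm (Fin m)) :
    Equiv.Perm.sign (insertPair j τ) = (-1) ^ (j : ℕ) * Equiv.Perm.sign τ := by
  rw [insertPair, Equiv.Perm.decomposeFin.symm_sign]
  simp [Equiv.Perm.decomposeFin.symm_sign, Fin.sign_cycleRange]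

theorem insertPair_injective {m : ℕ} :
    Function.Injective fun p : Fin (m + 1) × Equiv.Perm (Fin m) => insertPair p.1 p.2 := by
  rintro ⟨j, τ⟩ ⟨j', τ'⟩ h
  simp only at h
  have h1 : j = j' := by
    have := congrArg (fun σ => σ 1) h
    simpa [insertPair_one] using this
  subst h1
  congr 1
  ext1 i
  have := congrArg (fun σ => σ i.succ.succ) h
  simpa [insertPair_succ_succ] using this

theorem exists_insertPair_eq {m : ℕ} (σ : Equiv.Perm (Fin (m + 2))) (h : σ 0 = 0) :
    ∃ j τ, insertPair j τ = σ := by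
  obtain ⟨⟨p, ρ⟩, rfl⟩ := Equiv.Perm.decomposeFin.symm.surjective σ
  have hp : p = 0 := by simpa using h
  subst hp
  -- Composing with the cycle that takes `ρ 0` back to 0 leaves a permutation fixing 0, whose
  -- restriction is τ.
  obtain ⟨⟨q, τ⟩, hq⟩ := Equiv.Perm.decomposeFin.symm.surjective ((ρ 0).cycleRange * ρ)
  have hq0 : q = 0 := by
    have := congrArg (fun σ => σ 0) hq
    simpa using this
  subst hq0
  refine ⟨ρ 0, τ, ?_⟩
  rw [insertPair, hq]
  congr 2
  ext1 i
  simp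

theorem IsMatchingPerm.apply_zero {k : ℕ} {σ : Equiv.Perm (Fin (2 * (k + 1)))}
    (h : IsMatchingPerm σ) : σ ⟨0, by omega⟩ = ⟨0, by omega⟩ := by
  obtain ⟨i, hi⟩ := σ.surjective ⟨0, by omega⟩
  -- The value 0 cannot be second in its block, nor first in a block other than the initial one.
  rcases Nat.even_or_odd' (i : ℕ) with ⟨t, ht | ht⟩
  · rcases Nat.eq_zero_or_pos t with h0 | h0
    · have : i = ⟨0, by omega⟩ := Fin.ext (by simp [ht, h0])
      exact this ▸ hi
    · have := h.2 ⟨0, by omega⟩ ⟨t, by omega⟩ (by simpa [Fin.lt_def] using h0)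
      have hi' : (⟨2 * t, by omega⟩ : Fin (2 * (k + 1))) = i := Fin.ext ht.symm
      simp only [hi', hi, Fin.lt_def] at this
      omega
  · have := h.1 ⟨t, by omega⟩
    have hi' : (⟨2 * t + 1, by omega⟩ : Fin (2 * (k + 1))) = i := Fin.ext ht.symm
    simp only [hi', hi, Fin.lt_def] at this
    omega

theorem isMatchingPerm_insertPair {k : ℕ} (j : Fin (2 * k + 1)) (τ : Equiv.Perm (Fin (2 * k))) :
    IsMatchingPerm (k := k + 1) (insertPair j τ) ↔ IsMatchingPerm τ := by
  have e0 : ∀ i : Fin k, insertPair j τ ⟨2 * (i.succ : Fin (k + 1)), by omega⟩ =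
      (j.succAbove (τ ⟨2 * i, by omega⟩)).succ := fun i => insertPair_succ_succ j τ ⟨2 * i, by omega⟩
  have e1 : ∀ i : Fin k, insertPair j τ ⟨2 * (i.succ : Fin (k + 1)) + 1, by omega⟩ =
      (j.succAbove (τ ⟨2 * i + 1, by omega⟩)).succ :=
    fun i => insertPair_succ_succ j τ ⟨2 * i + 1, by omega⟩
  have z0 : insertPair j τ ⟨2 * ((0 : Fin (k + 1)) : ℕ), by simp⟩ = 0 := insertPair_zero j τ
  have z1 : insertPair j τ ⟨2 * ((0 : Fin (k + 1)) : ℕ) + 1, by simp⟩ = j.succ :=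
    insertPair_one j τ
  have hs : ∀ i i' : Fin (2 * k), (j.succAbove i).succ < (j.succAbove i').succ ↔ i < i' :=
    fun i i' => Fin.succ_lt_succ_iff.trans Fin.succAbove_lt_succAbove_iff
  have h1 := fun i : Fin k => (iff_of_eq (congrArg₂ (· < ·) (e0 i) (e1 i))).trans (hs _ _)
  have h2 := fun i i' : Fin k => (iff_of_eq (congrArg₂ (· < ·) (e0 i) (e0 i'))).trans (hs _ _)
  have h3 := (iff_of_eq (congrArg₂ (· < ·) z0 z1)).2 (Fin.succ_pos j)
  have h4 := fun i : Fin k =>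
    (iff_of_eq (congrArg₂ (· < ·) z0 (e0 i))).2 (Fin.succ_pos _)
  constructor
  · intro h
    exact ⟨fun i => (h1 i).1 (h.1 i.succ),
      fun i i' hi => (h2 i i').1 (h.2 i.succ i'.succ (Fin.succ_lt_succ_iff.2 hi))⟩
  · intro h
    refine ⟨fun i => Fin.cases h3 (fun i => (h1 i).2 (h.1 i)) i, fun i i' => ?_⟩
    refine Fin.cases (fun hi => absurd hi (Fin.not_lt_zero i)) (fun i' => ?_) i'
    exact Fin.cases (fun _ => h4 i')
      (fun i hi => (h2 i i').2 (h.2 i i' (Fin.succ_lt_succ_iff.1 hi))) i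

/-- Expansion of the Pfaffian along the first row. -/
theorem pfaffian_succ_succ {m : ℕ} (A : Matrix (Fin (m + 2)) (Fin (m + 2)) R) :
    pfaffian A = ∑ j : Fin (m + 1), (-1) ^ (j : ℕ) * A 0 j.succ *
      pfaffian (A.submatrix (fun i => (j.succAbove i).succ) fun i => (j.succAbove i).succ) := by
  classical
  by_cases hm : Even m
  · obtain ⟨k, rfl⟩ := hm.two_dvd
    simp_rw [pfaffian_two_mul (k := k)]
    rw [show pfaffian A = _ from pfaffian_two_mul (k := k + 1) A]
    simp_rw [Finset.mul_sum]
    rw [Finset.sum_sigma']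
    symm
    refine Finset.sum_bij (fun p _ => insertPair p.1 p.2) ?_ ?_ ?_ ?_
    · rintro ⟨j, τ⟩ h
      simp only [Finset.mem_sigma, Finset.mem_univ, true_and, Finset.mem_filter] at h ⊢
      exact (isMatchingPerm_insertPair j τ).2 h
    · rintro ⟨j, τ⟩ _ ⟨j', τ'⟩ _ h
      have := insertPair_injective (a₁ := (j, τ)) (a₂ := (j', τ')) h
      simp only [Prod.mk.injEq] at this
      obtain ⟨rfl, rfl⟩ := this
      rfl
    · intro σ hσ
      simp only [Finset.mem_univ, true_and, Finset.mem_filter] at hσ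
      obtain ⟨j, τ, rfl⟩ := exists_insertPair_eq (m := 2 * k) σ hσ.apply_zero
      refine ⟨⟨j, τ⟩, ?_, rfl⟩
      simpa using (isMatchingPerm_insertPair j τ).1 hσ
    · rintro ⟨j, τ⟩ _
      simp only
      rw [sign_insertPair, Fin.prod_univ_succ]
      have h0 : A (insertPair j τ ⟨2 * ((0 : Fin (k + 1)) : ℕ), by simp⟩)
          (insertPair j τ ⟨2 * ((0 : Fin (k + 1)) : ℕ) + 1, by simp⟩) = A 0 j.succ :=
        congrArg₂ A (insertPair_zero j τ) (insertPair_one j τ)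
      have hs : ∀ i : Fin k, A (insertPair j τ ⟨2 * (i.succ : Fin (k + 1)), by omega⟩)
          (insertPair j τ ⟨2 * (i.succ : Fin (k + 1)) + 1, by omega⟩) =
          A (j.succAbove (τ ⟨2 * i, by omega⟩)).succ
            (j.succAbove (τ ⟨2 * i + 1, by omega⟩)).succ := fun i =>
        congrArg₂ A (insertPair_succ_succ j τ ⟨2 * i, by omega⟩)
          (insertPair_succ_succ j τ ⟨2 * i + 1, by omega⟩)
      erw [h0, Finset.prod_congr rfl fun i _ => hs i]
      simp only [Matrix.submatrix_apply]
      push_cast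
      ring
  · rw [pfaffian_of_not_even (by rwa [Nat.even_add_one, Nat.even_add_one, not_not])]
    simp [pfaffian_of_not_even hm]

end PfaffianExpansion

/-! ### The Pfaffian as a functional on the exterior algebra. -/

section PfaffianForm

open CliffordAlgebra

variable {R M : Type*} [CommRing R] [AddCommGroup M] [Module R M]

@[elab_as_elim]
theorem exteriorAlgebra_induction {P : ExteriorAlgebra R M → Prop}
    (algebraMap : ∀ r, P (algebraMap R (ExteriorAlgebra R M) r))
    (add : ∀ x y, P x → P y → P (x + y))
    (ι_mul : ∀ x m, P x → P (ExteriorAlgebra.ι R m * x)) (x : ExteriorAlgebra R M) : P x :=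
  CliffordAlgebra.left_induction (Q := (0 : QuadraticForm R M)) (P := P)
    algebraMap add ι_mul x

/-- This makes `changeForm` by `-B` an endomorphism of the exterior algebra; the sign cancels the
one in `changeForm_ι_mul`. -/
theorem toQuadraticMap_neg_of_isAlt {B : LinearMap.BilinForm R M} (hB : B.IsAlt) :
    (-B).toQuadraticMap = (0 : QuadraticForm R M) - 0 := by
  ext m
  simp [hB m]

/-- The automorphism `exp` of the contraction by an alternating form. -/
noncomputable def contractExp (B : LinearMap.BilinForm R M) (hB : B.IsAlt) :
    Module.End R (ExteriorAlgebra R M) :=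
  changeForm (toQuadraticMap_neg_of_isAlt hB)

/-- The contraction by a linear form, as an operator on the exterior algebra. -/
noncomputable def contraction : Module.Dual R M →ₗ[R] Module.End R (ExteriorAlgebra R M) :=
  contractLeft (Q := 0)

/-- The linear functional on the exterior algebra given on products of vectors by the Pfaffian of
their Gram matrix. -/
noncomputable def pfaffianForm (B : LinearMap.BilinForm R M) (hB : B.IsAlt) :
    ExteriorAlgebra R M →ₗ[R] R :=
  ExteriorAlgebra.algebraMapInv.toLinearMap ∘ₗ contractExp B hB

theorem contraction_ι_mul (d : Module.Dual R M) (m : M) (x : ExteriorAlgebra R M) :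
    contraction d (ExteriorAlgebra.ι R m * x) =
      d m • x - ExteriorAlgebra.ι R m * contraction d x :=
  contractLeft_ι_mul d m x

theorem contraction_algebraMap (d : Module.Dual R M) (r : R) :
    contraction d (algebraMap R (ExteriorAlgebra R M) r) = 0 :=
  contractLeft_algebraMap 0 d r

theorem contraction_mul_self (d : Module.Dual R M) : contraction d * contraction d = 0 :=
  LinearMap.ext fun x => contractLeft_contractLeft (Q := 0) d x

theorem contraction_mul_comm (d d' : Module.Dual R M) :
    contraction d * contraction d' = -(contraction d' * contraction d) :=
  LinearMap.ext fun x => contractLeft_comm (Q := 0) d d' x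

theorem contractExp_algebraMap (B : LinearMap.BilinForm R M) (hB : B.IsAlt) (r : R) :
    contractExp B hB (algebraMap R _ r) = algebraMap R _ r :=
  changeForm_algebraMap _ r

theorem contractExp_ι_mul (B : LinearMap.BilinForm R M) (hB : B.IsAlt) (m : M)
    (x : ExteriorAlgebra R M) :
    contractExp B hB (ExteriorAlgebra.ι R m * x) =
      ExteriorAlgebra.ι R m * contractExp B hB x + contraction (B m) (contractExp B hB x) := by
  have := changeForm_ι_mul (toQuadraticMap_neg_of_isAlt hB) m x
  simp only [LinearMap.neg_apply, map_neg, sub_neg_eq_add] at this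
  exact this

theorem contractExp_mul_contraction (B : LinearMap.BilinForm R M) (hB : B.IsAlt)
    (d : Module.Dual R M) :
    contractExp B hB * contraction d = contraction d * contractExp B hB :=
  LinearMap.ext fun x => changeForm_contractLeft _ d x

/-- Both sides obey the same recursion on `ι m * x`, because exponentials commute with contractions
by linear forms. -/
theorem contractExp_add (B C : LinearMap.BilinForm R M) (hB : B.IsAlt) (hC : C.IsAlt)
    (h : (B + C).IsAlt) :
    contractExp (B + C) h = contractExp B hB * contractExp C hC := by
  refine LinearMap.ext fun x => ?_
  induction x using exteriorAlgebra_induction with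
  | algebraMap r =>
    simp only [Module.End.mul_apply]
    rw [contractExp_algebraMap, contractExp_algebraMap, contractExp_algebraMap]
  | add x y hx hy => rw [map_add, map_add, hx, hy]
  | ι_mul x m hx =>
    have hc : ∀ d y, contractExp B hB (contraction d y) = contraction d (contractExp B hB y) :=
      fun d y => LinearMap.congr_fun (contractExp_mul_contraction B hB d) y
    simp only [Module.End.mul_apply] at hx ⊢
    rw [contractExp_ι_mul, contractExp_ι_mul, map_add, contractExp_ι_mul, hx, hc,
      LinearMap.add_apply, map_add, LinearMap.add_apply]
    abel

theorem pfaffianForm_contractExp (B C : LinearMap.BilinForm R M) (hB : B.IsAlt) (hC : C.IsAlt)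
    (h : (B + C).IsAlt) (x : ExteriorAlgebra R M) :
    pfaffianForm B hB (contractExp C hC x) = pfaffianForm (B + C) h x := by
  simp only [pfaffianForm, LinearMap.comp_apply]
  rw [contractExp_add B C hB hC h]
  rfl

/-- The alternating form `f ∧ g`. -/
def wedge (f g : Module.Dual R M) : LinearMap.BilinForm R M :=
  LinearMap.toSpanSingleton R _ g ∘ₗ f - LinearMap.toSpanSingleton R _ f ∘ₗ g

theorem wedge_apply (f g : Module.Dual R M) (m m' : M) :
    wedge f g m m' = f m * g m' - g m * f m' := by
  simp [wedge]

theorem wedge_isAlt (f g : Module.Dual R M) : (wedge f g).IsAlt := fun m => by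
  rw [wedge_apply]; ring

/-- The exponential series stops after the linear term, since the contractions by f and g
anticommute and square to zero. -/
theorem contractExp_wedge (f g : Module.Dual R M) :
    contractExp (wedge f g) (wedge_isAlt f g) = 1 + contraction g * contraction f := by
  refine LinearMap.ext fun x => ?_
  induction x using exteriorAlgebra_induction with
  | algebraMap r =>
    simp only [LinearMap.add_apply, Module.End.mul_apply, Module.End.one_apply]
    rw [contractExp_algebraMap, contraction_algebraMap, map_zero, add_zero]
  | add x y hx hy => rw [map_add, map_add, hx, hy]
  | ι_mul x m hx =>
    have hw : wedge f g m = f m • g - g m • f := by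
      ext m'; simp [wedge_apply]
    have hgg : ∀ y, contraction g (contraction g y) = 0 := fun y =>
      LinearMap.congr_fun (contraction_mul_self g) y
    have hff : ∀ y, contraction f (contraction f y) = 0 := fun y =>
      LinearMap.congr_fun (contraction_mul_self f) y
    have hfg : ∀ y, contraction f (contraction g y) = - contraction g (contraction f y) := fun y =>
      LinearMap.congr_fun (contraction_mul_comm f g) y
    simp only [LinearMap.add_apply, Module.End.mul_apply, Module.End.one_apply] at hx ⊢
    rw [contractExp_ι_mul, contraction_ι_mul, map_sub, map_smul, contraction_ι_mul, hx, hw]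
    simp only [map_sub, map_smul, map_add, LinearMap.sub_apply, LinearMap.smul_apply, hgg, hfg,
      hff, map_zero, neg_zero, smul_zero, mul_add]
    abel

theorem pfaffianForm_one (B : LinearMap.BilinForm R M) (hB : B.IsAlt) :
    pfaffianForm B hB 1 = 1 := by
  have := contractExp_algebraMap B hB 1
  rw [map_one] at this
  simp [pfaffianForm, this]

theorem pfaffianForm_ι_mul (B : LinearMap.BilinForm R M) (hB : B.IsAlt) (m : M)
    (x : ExteriorAlgebra R M) :
    pfaffianForm B hB (ExteriorAlgebra.ι R m * x) = pfaffianForm B hB (contraction (B m) x) := by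
  have hc : contractExp B hB (contraction (B m) x) = contraction (B m) (contractExp B hB x) :=
    LinearMap.congr_fun (contractExp_mul_contraction B hB (B m)) x
  simp only [pfaffianForm, LinearMap.comp_apply, contractExp_ι_mul, hc, map_add]
  simp [ExteriorAlgebra.algebraMapInv]

theorem contraction_ιMulti_succ {m : ℕ} (d : Module.Dual R M) (v : Fin (m + 1) → M) :
    contraction d (ExteriorAlgebra.ιMulti R (m + 1) v) =
      ∑ j : Fin (m + 1), ((-1) ^ (j : ℕ) * d (v j)) •
        ExteriorAlgebra.ιMulti R m (fun i => v (j.succAbove i)) := by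
  induction m with
  | zero =>
    rw [ExteriorAlgebra.ιMulti_succ_apply, contraction_ι_mul, ExteriorAlgebra.ιMulti_zero_apply,
      ← map_one (algebraMap R _), contraction_algebraMap]
    simp
  | succ m ih =>
    rw [ExteriorAlgebra.ιMulti_succ_apply, contraction_ι_mul, ih,
      Fin.sum_univ_succ (n := m + 1), Finset.mul_sum, sub_eq_add_neg, ← Finset.sum_neg_distrib]
    congr 1
    · simp [Matrix.vecTail, Function.comp_def]
    · refine Finset.sum_congr rfl fun j _ => ?_
      rw [ExteriorAlgebra.ιMulti_succ_apply (fun i => v (j.succ.succAbove i)), Algebra.mul_smul_comm,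
        ← neg_smul]
      congr 1
      · simp [Matrix.vecTail, pow_succ]
      · simp [Matrix.vecTail, Function.comp_def]

/-- Removing the first vector turns it into a contraction, whose alternating sum over the other
vectors is the expansion along the first row. The size drops by two, whence the strong induction. -/
theorem pfaffianForm_ιMulti (B : LinearMap.BilinForm R M) (hB : B.IsAlt) {m : ℕ} (v : Fin m → M) :
    pfaffianForm B hB (ExteriorAlgebra.ιMulti R m v) =
      pfaffian (Matrix.of fun i j => B (v i) (v j)) := by
  induction m using Nat.strong_induction_on with
  | _ m ih =>
    match m with
    | 0 => rw [ExteriorAlgebra.ιMulti_zero_apply, pfaffianForm_one, pfaffian_fin_zero]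
    | 1 =>
      rw [pfaffian_of_not_even (by decide), ExteriorAlgebra.ιMulti_succ_apply, pfaffianForm_ι_mul,
        ExteriorAlgebra.ιMulti_zero_apply, ← map_one (algebraMap R _), contraction_algebraMap,
        map_zero]
    | m + 2 =>
      rw [pfaffian_succ_succ, ExteriorAlgebra.ιMulti_succ_apply, pfaffianForm_ι_mul,
        contraction_ιMulti_succ, map_sum]
      refine Finset.sum_congr rfl fun j _ => ?_
      rw [map_smul, ih m (by omega), smul_eq_mul]
      rfl

/-- Expansion of a bordered Pfaffian along the border. -/
theorem pfaffianForm_contraction_ιMulti (B : LinearMap.BilinForm R M) (hB : B.IsAlt)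
    (d : Module.Dual R M) {m : ℕ} (v : Fin m → M) :
    pfaffianForm B hB (contraction d (ExteriorAlgebra.ιMulti R m v)) =
      pfaffian (bordered (fun i => d (v i)) (Matrix.of fun i j => B (v i) (v j))) := by
  match m with
  | 0 =>
    rw [pfaffian_of_not_even (by decide), ExteriorAlgebra.ιMulti_zero_apply,
      ← map_one (algebraMap R _), contraction_algebraMap, map_zero]
  | m + 1 =>
    rw [pfaffian_succ_succ, contraction_ιMulti_succ, map_sum]
    refine Finset.sum_congr rfl fun j _ => ?_
    rw [map_smul, pfaffianForm_ιMulti, smul_eq_mul]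
    rfl

/-- The automorphism of the exterior algebra that changes the sign of all vectors. -/
def parity : ExteriorAlgebra R M →ₐ[R] ExteriorAlgebra R M :=
  involute

theorem parity_ι (m : M) :
    parity (ExteriorAlgebra.ι R m) = -ExteriorAlgebra.ι R m :=
  involute_ι (Q := (0 : QuadraticForm R M)) m

theorem parity_contraction (d : Module.Dual R M) (x : ExteriorAlgebra R M) :
    parity (contraction d x) = -contraction d (parity x) := by
  induction x using exteriorAlgebra_induction with
  | algebraMap r =>
    rw [contraction_algebraMap, AlgHom.commutes, contraction_algebraMap, map_zero, neg_zero]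
  | add x y hx hy => rw [map_add, map_add, hx, hy, map_add, map_add, neg_add]
  | ι_mul x m hx =>
    rw [contraction_ι_mul, map_mul, parity_ι, neg_mul, map_neg, contraction_ι_mul, map_sub,
      map_smul, map_mul, parity_ι, hx]
    simp

theorem contractExp_parity (B : LinearMap.BilinForm R M) (hB : B.IsAlt)
    (x : ExteriorAlgebra R M) :
    contractExp B hB (parity x) = parity (contractExp B hB x) := by
  induction x using exteriorAlgebra_induction with
  | algebraMap r =>
    rw [contractExp_algebraMap, AlgHom.commutes, contractExp_algebraMap]
  | add x y hx hy => simp only [map_add, hx, hy]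
  | ι_mul x m hx =>
    rw [contractExp_ι_mul, map_mul, parity_ι, neg_mul, map_neg, contractExp_ι_mul, map_add,
      map_mul, parity_ι, parity_contraction, hx, neg_add, neg_mul]

theorem algebraMapInv_parity (x : ExteriorAlgebra R M) :
    ExteriorAlgebra.algebraMapInv (parity x) = ExteriorAlgebra.algebraMapInv x := by
  have : (ExteriorAlgebra.algebraMapInv (R := R) (M := M)).comp parity =
      ExteriorAlgebra.algebraMapInv := by
    refine ExteriorAlgebra.hom_ext (LinearMap.ext fun m => ?_)
    simp [parity_ι, ExteriorAlgebra.algebraMapInv]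
  exact DFunLike.congr_fun this x

theorem mul_ι_eq_ι_mul_parity (x : ExteriorAlgebra R M) (m : M) :
    x * ExteriorAlgebra.ι R m = ExteriorAlgebra.ι R m * parity x := by
  induction x using exteriorAlgebra_induction with
  | algebraMap r => rw [AlgHom.commutes, Algebra.commutes]
  | add x y hx hy => rw [map_add, add_mul, mul_add, hx, hy]
  | ι_mul x m' hx =>
    have h : ExteriorAlgebra.ι R m' * ExteriorAlgebra.ι R m =
        -(ExteriorAlgebra.ι R m * ExteriorAlgebra.ι R m') :=
      eq_neg_of_add_eq_zero_left (ExteriorAlgebra.ι_add_mul_swap m' m)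
    rw [map_mul, parity_ι, mul_assoc, hx, ← mul_assoc, h, neg_mul, neg_mul, mul_neg, mul_assoc]

/-- Moving the vector to the left introduces `parity`, which the functional does not see but which
anticommutes with contractions; the resulting sign turns `B m` into `B.flip m`. -/
theorem pfaffianForm_mul_ι (B : LinearMap.BilinForm R M) (hB : B.IsAlt) (m : M)
    (x : ExteriorAlgebra R M) :
    pfaffianForm B hB (x * ExteriorAlgebra.ι R m) =
      pfaffianForm B hB (contraction (B.flip m) x) := by
  have h : B.flip m = -B m := by
    ext m'
    exact (hB.neg_eq m m').symm
  have hinv : ∀ y, pfaffianForm B hB (parity y) = pfaffianForm B hB y := fun y => by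
    simp only [pfaffianForm, LinearMap.comp_apply, contractExp_parity, AlgHom.toLinearMap_apply,
      algebraMapInv_parity]
  rw [mul_ι_eq_ι_mul_parity, pfaffianForm_ι_mul, h, map_neg, LinearMap.neg_apply,
    ← hinv (-contraction (B m) x), map_neg, parity_contraction, neg_neg]

theorem contraction_mul_ι (d : Module.Dual R M) (m : M) (h : d m = 0) (x : ExteriorAlgebra R M) :
    contraction d (x * ExteriorAlgebra.ι R m) = contraction d x * ExteriorAlgebra.ι R m := by
  induction x using exteriorAlgebra_induction with
  | algebraMap r =>
    rw [← Algebra.smul_def, map_smul, contraction_algebraMap, zero_mul, ← mul_one (ExteriorAlgebra.ι R m),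
      contraction_ι_mul, h, ← map_one (algebraMap R _), contraction_algebraMap]
    simp
  | add x y hx hy => rw [add_mul, map_add, hx, hy, map_add, add_mul]
  | ι_mul x m' hx =>
    rw [mul_assoc, contraction_ι_mul, contraction_ι_mul, hx, sub_mul, smul_mul_assoc, mul_assoc]

theorem contraction_mul_prod_ι {I : Type*} (d : Module.Dual R M) (f : I → M) (h : ∀ i, d (f i) = 0)
    (l : List I) (x : ExteriorAlgebra R M) :
    contraction d (x * (l.map fun i => ExteriorAlgebra.ι R (f i)).prod) =
      contraction d x * (l.map fun i => ExteriorAlgebra.ι R (f i)).prod := by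
  induction l generalizing x with
  | nil => simp
  | cons i l ih =>
    simp only [List.map_cons, List.prod_cons, ← mul_assoc]
    rw [ih, contraction_mul_ι d _ (h i)]

/-- The product of the contractions indexed by a list, in reversed order. -/
noncomputable def contractionList {I : Type*} (v : I → Module.Dual R M) (l : List I) :
    Module.End R (ExteriorAlgebra R M) :=
  (l.reverse.map fun i => contraction (v i)).prod

theorem contractionList_cons {I : Type*} (v : I → Module.Dual R M) (i : I) (l : List I) :
    contractionList v (i :: l) = contractionList v l * contraction (v i) := by
  simp [contractionList]

/-- Vectors multiplied on the right can be traded for contractions one at a time: as the `f i` are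
mutually orthogonal, each contraction passes through the vectors already appended. -/
theorem pfaffianForm_contractionList (B : LinearMap.BilinForm R M) (hB : B.IsAlt) {I : Type*}
    (f : I → M) (h : ∀ i j, B (f i) (f j) = 0) (l : List I) (x : ExteriorAlgebra R M) :
    pfaffianForm B hB (contractionList (fun i => B.flip (f i)) l x) =
      pfaffianForm B hB (x * (l.reverse.map fun i => ExteriorAlgebra.ι R (f i)).prod) := by
  induction l generalizing x with
  | nil => simp [contractionList]
  | cons i l ih =>
    rw [contractionList_cons, Module.End.mul_apply, ih]
    simp only [List.reverse_cons, List.map_append, List.prod_append, List.map_cons, List.map_nil,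
      List.prod_singleton, ← mul_assoc]
    rw [pfaffianForm_mul_ι, contraction_mul_prod_ι _ f fun j => ?_]
    simpa using h j i

end PfaffianForm

/-! ### Summation over strict partitions by the largest part. -/

namespace StrictPartition

theorem mem_bounded {N : ℕ} {μ : StrictPartition} : μ ∈ bounded N ↔ ∀ p ∈ μ.parts, p ≤ N := by
  simp [bounded]

/-- Add a new largest part. -/
def cons (μ : StrictPartition) (p : ℕ) (hp : 0 < p) (h : ∀ q ∈ μ.parts, q < p) :
    StrictPartition where
  parts := p :: μ.parts
  decreasing := List.pairwise_cons.2 ⟨h, μ.decreasing⟩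
  pos := List.forall_mem_cons.2 ⟨hp, μ.pos⟩

/-- Remove the largest part. -/
def tail (μ : StrictPartition) : StrictPartition where
  parts := μ.parts.tail
  decreasing := μ.decreasing.tail
  pos p hp := μ.pos p (List.mem_of_mem_tail hp)

theorem parts_eq_cons_tail {N : ℕ} {μ : StrictPartition} (hμ : μ ∈ bounded (N + 1))
    (h : N + 1 ∈ μ.parts) : μ.parts = (N + 1) :: μ.tail.parts := by
  have hb := mem_bounded.1 hμ
  have hd := μ.decreasing
  change μ.parts = (N + 1) :: μ.parts.tail
  cases hl : μ.parts with
  | nil => simp [hl] at h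
  | cons r l =>
    rw [hl] at h hb hd
    rcases List.mem_cons.1 h with rfl | h'
    · rfl
    · have := (List.pairwise_cons.1 hd).1 _ h'
      have := hb r (by simp)
      omega

theorem sum_bounded_zero {A : Type*} [AddCommMonoid A] (f : List ℕ → A) :
    ∑ μ ∈ bounded 0, f μ.parts = f [] := by
  rw [Finset.sum_eq_single_of_mem empty]
  · rfl
  · simp [mem_bounded, empty]
  · intro μ hμ hne
    refine absurd (StrictPartition.ext (List.eq_nil_iff_forall_not_mem.2 fun p hp => ?_)) hne
    exact absurd (mem_bounded.1 hμ p hp) (by have := μ.pos p hp; omega)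

/-- Either N + 1 is not a part, or it is the first part and removing it leaves parts at most N. -/
theorem sum_bounded_succ {A : Type*} [AddCommMonoid A] (N : ℕ) (f : List ℕ → A) :
    ∑ μ ∈ bounded (N + 1), f μ.parts =
      ∑ μ ∈ bounded N, f μ.parts + ∑ μ ∈ bounded N, f ((N + 1) :: μ.parts) := by
  rw [← Finset.sum_filter_not_add_sum_filter (bounded (N + 1)) fun μ => N + 1 ∈ μ.parts]
  congr 1
  · refine Finset.sum_congr ?_ fun _ _ => rfl
    ext μ
    rw [Finset.mem_filter, mem_bounded, mem_bounded]
    constructor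
    · rintro ⟨h1, h2⟩ p hp
      exact Nat.le_of_lt_succ (lt_of_le_of_ne (h1 p hp) fun h => h2 (by rwa [h] at hp))
    · exact fun h => ⟨fun p hp => (h p hp).trans N.le_succ, fun hp => absurd (h _ hp) (by omega)⟩
  · refine Finset.sum_bij (fun μ _ => μ.tail) ?_ ?_ ?_ ?_
    · intro μ hμ
      obtain ⟨h1, h2⟩ := Finset.mem_filter.1 hμ
      have hd := μ.decreasing
      rw [parts_eq_cons_tail h1 h2, List.pairwise_cons] at hd
      exact mem_bounded.2 fun p hp => Nat.le_of_lt_succ (hd.1 p hp)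
    · intro μ hμ ν hν h
      obtain ⟨h1, h2⟩ := Finset.mem_filter.1 hμ
      obtain ⟨k1, k2⟩ := Finset.mem_filter.1 hν
      ext1
      rw [parts_eq_cons_tail h1 h2, parts_eq_cons_tail k1 k2, h]
    · intro μ hμ
      have hμ' := mem_bounded.1 hμ
      refine ⟨μ.cons (N + 1) N.succ_pos fun q hq => Nat.lt_succ_of_le (hμ' q hq), ?_, rfl⟩
      rw [Finset.mem_filter, mem_bounded]
      refine ⟨List.forall_mem_cons.2 ⟨le_rfl, fun p hp => (hμ' p hp).trans N.le_succ⟩, ?_⟩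
      simp [cons]
    · intro μ hμ
      obtain ⟨h1, h2⟩ := Finset.mem_filter.1 hμ
      rw [← parts_eq_cons_tail h1 h2]

end StrictPartition

/-! ### Sums of products of contractions as exponentials of two-forms. -/

section Operators

variable {R M : Type*} [CommRing R] [AddCommGroup M] [Module R M]

/-- `α_{p₁} β_{p₂} α_{p₃} ⋯` -/
def alternatingWeight (α β : ℕ → R) : List ℕ → R
  | [] => 1
  | p :: l => α p * alternatingWeight β α l

/-- Append a part `0` if needed to get a length of the parity of `n`. -/
def padTo (n : ℕ) (l : List ℕ) : List ℕ := if Even (n + l.length) then l else l ++ [0]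

theorem padTo_cons (n p : ℕ) (l : List ℕ) : padTo n (p :: l) = p :: padTo (n + 1) l := by
  have : n + (p :: l).length = n + 1 + l.length := by simp; omega
  unfold padTo
  rw [this]
  split_ifs <;> rfl

theorem padTo_add_two (n : ℕ) (l : List ℕ) : padTo (n + 2) l = padTo n l := by
  have : Even (n + 2 + l.length) ↔ Even (n + l.length) := by
    rw [show n + 2 + l.length = n + l.length + 2 by ring]; simp [Nat.even_add]
  simp [padTo, this]

variable (v : ℕ → Module.Dual R M) (α β : ℕ → R)

/-- The sum over the strict partitions with parts at most `N` of their alternating weight times the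
product of contractions. -/
noncomputable def partitionOperator (n N : ℕ) : Module.End R (ExteriorAlgebra R M) :=
  ∑ μ ∈ StrictPartition.bounded N,
    alternatingWeight α β μ.parts • contractionList v (padTo n μ.parts)

theorem partitionOperator_add_two (n N : ℕ) :
    partitionOperator v α β (n + 2) N = partitionOperator v α β n N := by
  simp only [partitionOperator, padTo_add_two]

theorem partitionOperator_succ (n N : ℕ) :
    partitionOperator v α β n (N + 1) = partitionOperator v α β n N +
      α (N + 1) • (partitionOperator v β α (n + 1) N * contraction (v (N + 1))) := by
  unfold partitionOperator
  rw [StrictPartition.sum_bounded_succ N fun l =>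
    alternatingWeight α β l • contractionList v (padTo n l), Finset.sum_mul, Finset.smul_sum]
  congr 1
  refine Finset.sum_congr rfl fun μ _ => ?_
  rw [padTo_cons, contractionList_cons, alternatingWeight, mul_smul, smul_mul_assoc]

/-- `∑_{p ≤ N} α_p v_p` -/
def weightedSum (N : ℕ) : Module.Dual R M := ∑ p ∈ Finset.range (N + 1), α p • v p

/-- `∑_{q < p ≤ N} α_p β_q v_p ∧ v_q` -/
def wedgeSum (N : ℕ) : LinearMap.BilinForm R M :=
  ∑ p ∈ Finset.range N, wedge (α (p + 1) • v (p + 1)) (weightedSum v β p)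

theorem wedgeSum_succ (N : ℕ) : wedgeSum v α β (N + 1) =
    wedgeSum v α β N + wedge (α (N + 1) • v (N + 1)) (weightedSum v β N) :=
  Finset.sum_range_succ _ _

theorem isAlt_add {B C : LinearMap.BilinForm R M} (hB : B.IsAlt) (hC : C.IsAlt) : (B + C).IsAlt :=
  fun m => by simp [hB m, hC m]

theorem wedgeSum_isAlt (N : ℕ) : (wedgeSum v α β N).IsAlt := by
  induction N with
  | zero => intro m; simp [wedgeSum]
  | succ N ih => rw [wedgeSum_succ]; exact isAlt_add ih (wedge_isAlt _ _)

theorem weightedSum_succ (N : ℕ) :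
    weightedSum v α (N + 1) = weightedSum v α N + α (N + 1) • v (N + 1) :=
  Finset.sum_range_succ _ _

theorem weightedSum_zero : weightedSum v α 0 = α 0 • v 0 := by
  simp [weightedSum]

/-- In the full double sum ∑ β_p α_q v_p ∧ v_q the diagonal vanishes; the terms with p > q give one
wedge sum and those with p < q the negative of the other. -/
theorem wedgeSum_swap (h : α 0 = β 0) (N : ℕ) :
    wedgeSum v β α N = wedgeSum v α β N + wedge (weightedSum v β N) (weightedSum v α N) := by
  induction N with
  | zero =>
    ext m m'
    simp [wedgeSum, weightedSum_zero, wedge_apply, h]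
  | succ N ih =>
    rw [wedgeSum_succ, wedgeSum_succ, ih, weightedSum_succ, weightedSum_succ]
    refine LinearMap.ext fun m => LinearMap.ext fun m' => ?_
    simp only [LinearMap.add_apply, wedge_apply, LinearMap.smul_apply, smul_eq_mul]
    ring

theorem contractExp_congr {B C : LinearMap.BilinForm R M} (h : B = C) (hB : B.IsAlt)
    (hC : C.IsAlt) : contractExp B hB = contractExp C hC := by
  subst h; rfl

theorem contractExp_wedgeSum_swap (h : α 0 = β 0) (N : ℕ) :
    contractExp (wedgeSum v β α N) (wedgeSum_isAlt v β α N) =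
      contractExp (wedgeSum v α β N) (wedgeSum_isAlt v α β N) *
        (1 + contraction (weightedSum v α N) * contraction (weightedSum v β N)) := by
  rw [contractExp_congr (wedgeSum_swap v α β h N) _
    (isAlt_add (wedgeSum_isAlt v α β N) (wedge_isAlt _ _)),
    contractExp_add _ _ (wedgeSum_isAlt v α β N) (wedge_isAlt _ _), contractExp_wedge]

theorem contractExp_wedgeSum_succ (N : ℕ) :
    contractExp (wedgeSum v α β (N + 1)) (wedgeSum_isAlt v α β (N + 1)) =
      contractExp (wedgeSum v α β N) (wedgeSum_isAlt v α β N) *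
        (1 + α (N + 1) • (contraction (weightedSum v β N) * contraction (v (N + 1)))) := by
  rw [contractExp_congr (wedgeSum_succ v α β N) _
    (isAlt_add (wedgeSum_isAlt v α β N) (wedge_isAlt _ _)),
    contractExp_add _ _ (wedgeSum_isAlt v α β N) (wedge_isAlt _ _), contractExp_wedge, map_smul,
    mul_smul_comm]

theorem contractExp_zero :
    contractExp (0 : LinearMap.BilinForm R M) (fun _ => by simp) = 1 := by
  have := contractExp_wedge (R := R) (M := M) 0 0
  rw [map_zero, zero_mul, add_zero] at this
  rw [← this]
  refine contractExp_congr ?_ _ _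
  ext; simp [wedge_apply]

theorem mul_mul_comm_of_anticomm {S : Type*} [Ring S] {A B D : S} (hab : A * B = -(B * A))
    (hda : D * A = -(A * D)) : B * D * A = A * B * D := by
  rw [mul_assoc, hda, mul_neg, ← mul_assoc, hab, neg_mul]

/-- The generating function of the products of contractions over strict partitions is the
exponential of the contraction by a two-form. -/
theorem partitionOperator_eq (hα : α 0 = 1) (hβ : β 0 = 1) (N : ℕ) :
    partitionOperator v α β 0 N = contractExp (wedgeSum v α β N) (wedgeSum_isAlt v α β N) ∧
    partitionOperator v α β 1 N = contractExp (wedgeSum v α β N) (wedgeSum_isAlt v α β N) *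
      contraction (weightedSum v α N) := by
  induction N generalizing α β with
  | zero =>
    have h0 : contractExp (wedgeSum v α β 0) (wedgeSum_isAlt v α β 0) = 1 := by
      rw [← contractExp_zero]
      exact contractExp_congr (by simp [wedgeSum]) _ _
    rw [h0, weightedSum_zero, hα]
    unfold partitionOperator
    rw [StrictPartition.sum_bounded_zero fun l =>
      alternatingWeight α β l • contractionList v (padTo 0 l), StrictPartition.sum_bounded_zero
        fun l => alternatingWeight α β l • contractionList v (padTo 1 l)]
    simp [alternatingWeight, padTo, contractionList]
  | succ N ih =>
    obtain ⟨h0, h1⟩ := ih α β hα hβ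
    obtain ⟨k0, k1⟩ := ih β α hβ hα
    have hs := contractExp_wedgeSum_swap v α β (hα.trans hβ.symm) N
    have hab := contraction_mul_comm (weightedSum v α N) (weightedSum v β N)
    have hbb := contraction_mul_self (weightedSum v β N)
    have hvv := contraction_mul_self (v (N + 1))
    have hva := contraction_mul_comm (v (N + 1)) (weightedSum v α N)
    rw [partitionOperator_succ, partitionOperator_succ, contractExp_wedgeSum_succ, zero_add,
      show 1 + 1 = 0 + 2 from rfl, partitionOperator_add_two, h0, h1, k0, k1, hs, weightedSum_succ,
      map_add, map_smul]
    -- What remains is algebra in F, A, B, D, where A, B, D anticommute and square to zero.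
    generalize contractExp (wedgeSum v α β N) (wedgeSum_isAlt v α β N) = F at *
    generalize contraction (weightedSum v α N) = A at *
    generalize contraction (weightedSum v β N) = B at *
    generalize contraction (v (N + 1)) = D at *
    constructor
    -- The swap factor is absorbed because B² = 0.
    · have : (1 + A * B) * B = B := by rw [add_mul, one_mul, mul_assoc, hbb, mul_zero, add_zero]
      rw [mul_assoc F, this, mul_add, mul_one, mul_smul_comm, mul_assoc]
    -- In F(1 + αBD)(A + αD), with α = `α (N + 1)`, the term BDD vanishes and BDA = ABD, which is
    -- the contribution of the swap factor.
    · have := mul_mul_comm_of_anticomm (A := A) (B := B) (D := D) hab hva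
      have h2 : B * D * D = 0 := by rw [mul_assoc, hvv, mul_zero]
      simp only [mul_add, add_mul, mul_one, mul_smul_comm, smul_mul_assoc, mul_assoc,
        smul_add] at this h2 ⊢
      rw [this, h2]
      simp only [smul_zero, mul_zero, add_zero]
      abel

end Operators

theorem map_pfaffian {R S : Type*} [CommRing R] [CommRing S] (f : R →+* S) {m : ℕ}
    (A : Matrix (Fin m) (Fin m) R) : f (pfaffian A) = pfaffian (A.map f) := by
  unfold pfaffian
  split_ifs
  · simp [map_sum, map_mul, map_prod]
  · exact map_zero f

/-! ### The Pfaffian formula for bounded parts. -/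

section FiniteSum

variable {R : Type*} [CommRing R]

/-- The bilinear form with given Gram matrix. -/
noncomputable def gramForm {I : Type*} (g : I → I → R) : LinearMap.BilinForm R (I →₀ R) :=
  Finsupp.linearCombination R fun i => Finsupp.linearCombination R (g i)

theorem gramForm_single {I : Type*} (g : I → I → R) (i j : I) :
    gramForm g (Finsupp.single i 1) (Finsupp.single j 1) = g i j := by
  simp [gramForm]

theorem gramForm_isAlt {I : Type*} (g : I → I → R) (h0 : ∀ i, g i i = 0)
    (h : ∀ i j, g j i = -g i j) : (gramForm g).IsAlt := by
  have hs : ∀ x y, gramForm g y x = -gramForm g x y := by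
    intro x y
    induction x using Finsupp.induction_linear with
    | zero => simp
    | add x x' hx hx' => rw [map_add, hx, hx', map_add, LinearMap.add_apply]; ring
    | single i r =>
      induction y using Finsupp.induction_linear with
      | zero => simp
      | add x x' hx hx' => rw [map_add, LinearMap.add_apply, hx, hx', map_add]; ring
      | single j s =>
        simp only [gramForm, Finsupp.linearCombination_single, LinearMap.smul_apply, smul_eq_mul,
          h i j]
        ring
  intro x
  induction x using Finsupp.induction_linear with
  | zero => simp
  | add x y hx hy =>
    rw [map_add, map_add, LinearMap.add_apply, LinearMap.add_apply, hx, hy, hs x y]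
    ring
  | single i r => simp [gramForm, h0]

variable {n : ℕ}

/-- The Gram matrix of the vectors `e_1, …, e_n, f_0, f_1, …` -/
def borderKernel (A : Matrix (Fin n) (Fin n) R) (y : Fin n → R) : Fin n ⊕ ℕ → Fin n ⊕ ℕ → R
  | .inl i, .inl j => A i j
  | .inl i, .inr p => y i ^ p
  | .inr p, .inl i => -y i ^ p
  | .inr _, .inr _ => 0

theorem gramForm_borderKernel_isAlt {A : Matrix (Fin n) (Fin n) R} (y : Fin n → R)
    (h0 : ∀ i, A i i = 0) (h : ∀ i j, A j i = -A i j) : (gramForm (borderKernel A y)).IsAlt := by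
  refine gramForm_isAlt _ ?_ ?_
  · rintro (i | p) <;> simp [borderKernel, h0]
  · rintro (i | p) (j | q)
    · exact h i j
    all_goals simp [borderKernel]

theorem pfaffianForm_contractionList_ιMulti {M I : Type*} [AddCommGroup M] [Module R M]
    (B : LinearMap.BilinForm R M) (hB : B.IsAlt) (f : I → M) (h : ∀ i j, B (f i) (f j) = 0)
    (l : List I) {m : ℕ} (e : Fin n → M) (w : Fin m → M)
    (hw : List.ofFn w = List.ofFn e ++ l.reverse.map f) :
    pfaffianForm B hB (contractionList (fun i => B.flip (f i)) l (ExteriorAlgebra.ιMulti R n e)) =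
      pfaffian (Matrix.of fun i j => B (w i) (w j)) := by
  rw [pfaffianForm_contractionList B hB f h, ← pfaffianForm_ιMulti B hB]
  congr 1
  have hm : ∀ {k : ℕ} (u : Fin k → M), ExteriorAlgebra.ιMulti R k u =
      ((List.ofFn u).map (ExteriorAlgebra.ι R)).prod := fun u => by
    rw [ExteriorAlgebra.ιMulti_apply, List.map_ofFn]; rfl
  rw [hm, hm, hw, List.map_append, List.prod_append, List.map_map]
  rfl

theorem ofFn_part_rev (μ : StrictPartition) :
    (List.ofFn fun j : Fin μ.length => μ.part (Fin.rev j)) = μ.parts.reverse := by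
  refine List.ext_getElem (by simp [StrictPartition.length]) fun i h1 h2 => ?_
  simp only [List.length_reverse] at h2
  rw [List.getElem_ofFn, List.getElem_reverse, StrictPartition.part, List.getD_eq_getElem]
  · congr 1
    simp [StrictPartition.length, Fin.rev]
    omega
  · simp [StrictPartition.length, Fin.rev]
    omega

theorem part_pos (μ : StrictPartition) (j : Fin μ.length) : 0 < μ.part j := by
  rw [StrictPartition.part, List.getD_eq_getElem _ _ j.2]
  exact μ.pos _ (List.getElem_mem _)

variable {K : Type*} [Field K]

theorem map_pfaffian_blockMatrix {M : Type*} [AddCommGroup M] [Module R M] (φ : K →+* R)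
    (B : LinearMap.BilinForm R M) (hB : B.IsAlt) (f : ℕ → M) (h : ∀ p q, B (f p) (f q) = 0)
    {m : ℕ} (X : Fin m → K) (E : Fin m → M) (hE : ∀ i j, B (E i) (E j) = φ (schurMatrix X i j))
    (hf : ∀ i p, 0 < p → B (E i) (f p) = φ (X i ^ p)) (μ : StrictPartition) :
    φ (pfaffian (blockMatrix X μ)) =
      pfaffian (Matrix.of fun i j =>
        B (Fin.append E (fun j : Fin μ.length => f (μ.part (Fin.rev j))) i)
          (Fin.append E (fun j : Fin μ.length => f (μ.part (Fin.rev j))) j)) := by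
  rw [map_pfaffian]
  congr 1
  ext i j
  have hr : ∀ j : Fin μ.length, 0 < μ.part (Fin.rev j) := fun j => part_pos μ (Fin.rev j)
  refine Fin.addCases (fun i => ?_) (fun i => ?_) i <;>
    refine Fin.addCases (fun j => ?_) (fun j => ?_) j
  · simp [blockMatrix, hE]
  · rw [Matrix.of_apply, Fin.append_left, Fin.append_right, hf _ _ (hr j)]
    simp [blockMatrix, powerMatrix]
  · rw [Matrix.of_apply, Fin.append_left, Fin.append_right, ← hB.neg_eq, hf _ _ (hr i)]
    simp [blockMatrix, powerMatrix]
  · simp [blockMatrix, h]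

theorem schurMatrix_self (x : Fin n → K) (i : Fin n) : schurMatrix x i i = 0 := by
  simp [schurMatrix]

theorem schurMatrix_swap (x : Fin n → K) (i j : Fin n) :
    schurMatrix x j i = -schurMatrix x i j := by
  simp only [schurMatrix, Matrix.of_apply, eq_comm (a := j)]
  split_ifs
  · simp
  · rw [add_comm, ← neg_sub, neg_div]

theorem map_pfMu (φ : K →+* R) (x : Fin n → K) (hx : ∀ i, x i ≠ 0) (μ : StrictPartition)
    (hB : (gramForm (borderKernel ((schurMatrix x).map φ) fun i => φ (x i))).IsAlt) :
    φ (pfMu x μ) = pfaffianForm _ hB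
      (contractionList (fun p => (gramForm (borderKernel ((schurMatrix x).map φ)
        fun i => φ (x i))).flip (Finsupp.single (Sum.inr p) 1)) (padTo n μ.parts)
        (ExteriorAlgebra.ιMulti R n fun i => Finsupp.single (Sum.inl i) 1)) := by
  have hf : ∀ p q : ℕ, gramForm (borderKernel ((schurMatrix x).map φ) fun i => φ (x i))
    (Finsupp.single (Sum.inr p) 1) (Finsupp.single (Sum.inr q) 1) = 0 :=
    fun p q => gramForm_single _ _ _
  have hlen : μ.parts.length = μ.length := rfl
  by_cases hn : Even (n + μ.length)
  · rw [pfMu, if_pos hn, padTo, hlen, if_pos hn, pfaffianForm_contractionList_ιMulti _ hB _ hf _ _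
      (Fin.append (fun i => Finsupp.single (Sum.inl i) 1)
        fun j : Fin μ.length => Finsupp.single (Sum.inr (μ.part (Fin.rev j))) 1)]
    · refine map_pfaffian_blockMatrix φ _ hB (fun p => Finsupp.single (Sum.inr p) 1) hf x
        (fun i => Finsupp.single (Sum.inl i) 1) (fun i j => ?_) (fun i p _ => ?_) μ
      · rw [gramForm_single]; rfl
      · rw [gramForm_single, map_pow]; rfl
    · rw [List.ofFn_fin_append, ← ofFn_part_rev, List.map_ofFn]
      rfl
  · rw [pfMu, if_neg hn, padTo, hlen, if_neg hn, pfaffianForm_contractionList_ιMulti _ hB _ hf _ _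
      (Fin.append (Fin.snoc (fun i => Finsupp.single (Sum.inl i) 1)
          (Finsupp.single (Sum.inr 0) 1) : Fin (n + 1) → _)
        fun j : Fin μ.length => Finsupp.single (Sum.inr (μ.part (Fin.rev j))) 1)]
    -- The added variable 0 plays the role of `f_0`: (x_i - 0)/(x_i + 0) = 1 = x_i^0 as x_i ≠ 0, and
    -- 0^p = 0 for p > 0 agrees with B(f_0, f_p) = 0.
    · refine map_pfaffian_blockMatrix φ _ hB (fun p => Finsupp.single (Sum.inr p) 1) hf _
        _ (fun i j => ?_) (fun i p hp => ?_) μ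
      · refine Fin.lastCases ?_ (fun i => ?_) i <;> refine Fin.lastCases ?_ (fun j => ?_) j
        · simp [schurMatrix, gramForm_single, borderKernel]
        · have : Fin.last n ≠ j.castSucc := (Fin.castSucc_lt_last j).ne'
          simp [schurMatrix, gramForm_single, borderKernel, this, hx]
        · have : i.castSucc ≠ Fin.last n := (Fin.castSucc_lt_last i).ne
          simp [schurMatrix, gramForm_single, borderKernel, this, hx]
        · simp [schurMatrix, gramForm_single, borderKernel]
      · refine Fin.lastCases ?_ (fun i => ?_) i
        · simp [gramForm_single, borderKernel, hp.ne']
        · simp [gramForm_single, borderKernel]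
    · rw [List.ofFn_fin_append, List.ofFn_succ']
      simp only [Fin.snoc_castSucc, Fin.snoc_last, List.concat_eq_append, List.append_assoc,
        List.reverse_append, List.map_append, List.reverse_singleton, List.map_singleton,
        ← ofFn_part_rev, List.map_ofFn]
      rfl

/-- `∑_{q < p ≤ N} α_p β_q X^p Y^q` -/
def doubleSum (α β : ℕ → R) (X Y : R) (N : ℕ) : R :=
  ∑ p ∈ Finset.range N, α (p + 1) * X ^ (p + 1) * ∑ q ∈ Finset.range (p + 1), β q * Y ^ q

/-- The Pfaffian formula for the sum over the strict partitions with bounded parts. -/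
theorem sum_bounded_alternatingWeight_mul_pfMu (φ : K →+* R) (x : Fin n → K) (hx : ∀ i, x i ≠ 0)
    (α β : ℕ → R) (hα : α 0 = 1) (hβ : β 0 = 1) (N : ℕ) :
    (Even n → ∑ μ ∈ StrictPartition.bounded N,
        alternatingWeight α β μ.parts * φ (pfMu x μ) =
      pfaffian (Matrix.of fun i j => φ (schurMatrix x i j) +
        (doubleSum α β (φ (x i)) (φ (x j)) N - doubleSum α β (φ (x j)) (φ (x i)) N))) ∧
    (Odd n → ∑ μ ∈ StrictPartition.bounded N,
        alternatingWeight α β μ.parts * φ (pfMu x μ) =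
      pfaffian (bordered (fun i => ∑ p ∈ Finset.range (N + 1), α p * φ (x i) ^ p)
        (Matrix.of fun i j => φ (schurMatrix x i j) +
        (doubleSum α β (φ (x i)) (φ (x j)) N - doubleSum α β (φ (x j)) (φ (x i)) N)))) := by
  have hB : (gramForm (borderKernel ((schurMatrix x).map φ) fun i => φ (x i))).IsAlt := by
    refine gramForm_borderKernel_isAlt _ (fun i => ?_) fun i j => ?_
    · simp [schurMatrix_self]
    · simp [schurMatrix_swap x i j]
  have hsum : ∑ μ ∈ StrictPartition.bounded N, alternatingWeight α β μ.parts * φ (pfMu x μ) =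
      pfaffianForm _ hB (partitionOperator (fun p => (gramForm (borderKernel ((schurMatrix x).map φ)
        fun i => φ (x i))).flip (Finsupp.single (Sum.inr p) 1)) α β n N
        (ExteriorAlgebra.ιMulti R n fun i => Finsupp.single (Sum.inl i) 1)) := by
    unfold partitionOperator
    rw [LinearMap.sum_apply, map_sum]
    refine Finset.sum_congr rfl fun μ _ => ?_
    rw [LinearMap.smul_apply, map_smul, smul_eq_mul, map_pfMu φ x hx μ hB]
  -- The padding depends only on the parity of n, so the cases 0 and 1 suffice.
  have hpar : ∀ k : ℕ, ∀ v : ℕ → Module.Dual R (Fin n ⊕ ℕ →₀ R),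
      partitionOperator v α β (k + k) N = partitionOperator v α β 0 N ∧
      partitionOperator v α β (2 * k + 1) N = partitionOperator v α β 1 N := by
    intro k v
    induction k with
    | zero => exact ⟨rfl, rfl⟩
    | succ k ih =>
      rw [← ih.1, ← ih.2, ← partitionOperator_add_two v α β (k + k),
        ← partitionOperator_add_two v α β (2 * k + 1)]
      exact ⟨congrArg (fun m => partitionOperator v α β m N) (by ring),
        congrArg (fun m => partitionOperator v α β m N) (by ring)⟩
  generalize hv : (fun p => (gramForm (borderKernel ((schurMatrix x).map φ)
        fun i => φ (x i))).flip (Finsupp.single (Sum.inr p) 1)) = v at hsum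
  have hve : ∀ p i, v p (Finsupp.single (Sum.inl i) 1) = φ (x i) ^ p := by
    intro p i
    rw [← hv]
    exact gramForm_single _ _ _
  obtain ⟨h0, h1⟩ := partitionOperator_eq v α β hα hβ N
  have hws : ∀ N (γ : ℕ → R) i, weightedSum v γ N (Finsupp.single (Sum.inl i) 1) =
      ∑ p ∈ Finset.range (N + 1), γ p * φ (x i) ^ p := by
    intro N γ i
    simp [weightedSum, hve, LinearMap.sum_apply]
  have hent : ∀ i j, (gramForm (borderKernel ((schurMatrix x).map φ) fun i => φ (x i)) +
      wedgeSum v α β N) (Finsupp.single (Sum.inl i) 1) (Finsupp.single (Sum.inl j) 1) =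
      φ (schurMatrix x i j) +
        (doubleSum α β (φ (x i)) (φ (x j)) N - doubleSum α β (φ (x j)) (φ (x i)) N) := by
    intro i j
    rw [LinearMap.add_apply, LinearMap.add_apply, gramForm_single]
    congr 1
    rw [wedgeSum, LinearMap.sum_apply, LinearMap.sum_apply, doubleSum, doubleSum,
      ← Finset.sum_sub_distrib]
    refine Finset.sum_congr rfl fun p _ => ?_
    rw [wedge_apply, hws, hws, LinearMap.smul_apply, LinearMap.smul_apply, hve, hve, smul_eq_mul,
      smul_eq_mul]
    ring
  have hBw := isAlt_add hB (wedgeSum_isAlt v α β N)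
  constructor
  · rintro ⟨k, rfl⟩
    rw [hsum, (hpar k v).1, h0, pfaffianForm_contractExp _ _ _ _ hBw, pfaffianForm_ιMulti]
    simp_rw [hent]
  · rintro ⟨k, rfl⟩
    rw [hsum, (hpar k v).2, h1, Module.End.mul_apply, pfaffianForm_contractExp _ _ _ _ hBw,
      pfaffianForm_contraction_ιMulti]
    simp_rw [hent, hws]

end FiniteSum

/-! ### The four parameter weight and its geometric sums. -/

section Weights

variable {R : Type*} [CommRing R]

/-- The weight `z a^⌈p/2⌉ b^⌊p/2⌋` of a positive part `p`. -/
def partWeight (a b z : R) (p : ℕ) : R := if p = 0 then 1 else z * (a ^ ((p + 1) / 2) * b ^ (p / 2))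

theorem partWeight_zero (a b z : R) : partWeight a b z 0 = 1 := if_pos rfl

theorem partWeight_odd (a b z : R) (k : ℕ) :
    partWeight a b z (2 * k + 1) = z * (a ^ (k + 1) * b ^ k) := by
  rw [partWeight, if_neg (by omega), show (2 * k + 1 + 1) / 2 = k + 1 by omega,
    show (2 * k + 1) / 2 = k by omega]

theorem partWeight_even (a b z : R) (k : ℕ) :
    partWeight a b z (2 * k + 2) = z * (a ^ (k + 1) * b ^ (k + 1)) := by
  rw [partWeight, if_neg (by omega), show (2 * k + 2 + 1) / 2 = k + 1 by omega,
    show (2 * k + 2) / 2 = k + 1 by omega]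

theorem sum_range_even_getD_cons (g : ℕ → ℕ) (p : ℕ) (l : List ℕ) :
    ∑ i ∈ Finset.range (p :: l).length with Even i, g ((p :: l).getD i 0) =
      g p + ∑ i ∈ Finset.range l.length with Odd i, g (l.getD i 0) := by
  rw [Finset.sum_filter, Finset.sum_filter, List.length_cons, Finset.sum_range_succ', add_comm]
  simp [Nat.even_add_one]

theorem sum_range_odd_getD_cons (g : ℕ → ℕ) (p : ℕ) (l : List ℕ) :
    ∑ i ∈ Finset.range (p :: l).length with Odd i, g ((p :: l).getD i 0) =
      ∑ i ∈ Finset.range l.length with Even i, g (l.getD i 0) := by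
  rw [Finset.sum_filter, Finset.sum_filter, List.length_cons, Finset.sum_range_succ']
  simp [Nat.odd_add_one]

/-- Removing the first part exchanges odd and even positions, hence (a, b) and (c, d); the induction
therefore generalizes over the four parameters. -/
theorem weight_mul_pow_length (a b c d z : R) (μ : StrictPartition) :
    μ.weight a b c d * z ^ μ.length =
      alternatingWeight (partWeight a b z) (partWeight c d z) μ.parts := by
  obtain ⟨l, hd, hl⟩ := μ
  simp only [StrictPartition.weight, StrictPartition.length, StrictPartition.part]
  clear hd
  induction l generalizing a b c d with
  | nil => simp [alternatingWeight]
  | cons p l ih =>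
    have hp : p ≠ 0 := (hl p (by simp)).ne'
    rw [sum_range_even_getD_cons (fun p => (p + 1) / 2), sum_range_even_getD_cons (fun p => p / 2),
      sum_range_odd_getD_cons (fun p => (p + 1) / 2), sum_range_odd_getD_cons (fun p => p / 2),
      alternatingWeight, ← ih c d a b fun q hq => hl q (by simp [hq]), partWeight, if_neg hp,
      List.length_cons]
    ring

theorem sum_range_partWeight (a b z X : R) (k : ℕ) :
    ∑ p ∈ Finset.range (2 * k + 1), partWeight a b z p * X ^ p =
      1 + z * (a * X + a * b * X ^ 2) * ∑ r ∈ Finset.range k, (a * b * X ^ 2) ^ r := by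
  induction k with
  | zero => simp [partWeight_zero]
  | succ k ih =>
    rw [show 2 * (k + 1) + 1 = 2 * k + 1 + 1 + 1 by ring, Finset.sum_range_succ,
      Finset.sum_range_succ, ih, partWeight_odd, partWeight_even, Finset.sum_range_succ]
    ring

theorem one_sub_mul_sum_range_partWeight (a b z X : R) (k : ℕ) :
    (1 - a * b * X ^ 2) * ∑ p ∈ Finset.range (2 * k + 1), partWeight a b z p * X ^ p =
      (1 - a * b * X ^ 2 + z * (a * X + a * b * X ^ 2)) +
        (a * b * X ^ 2) ^ k * -(z * (a * X + a * b * X ^ 2)) := by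
  rw [sum_range_partWeight]
  linear_combination (z * (a * X + a * b * X ^ 2)) * mul_neg_geom_sum (a * b * X ^ 2) k

/-- The numerator of the limit of `doubleSum`. -/
def doubleSumNum (a b c d z X Y : R) : R :=
  (1 - a * b * c * d * X ^ 2 * Y ^ 2) * (a * X + a * b * X ^ 2) * z +
    a * b * X ^ 2 * z ^ 2 *
      ((a * X + a * b * X ^ 2) * (c * Y + c * d * Y ^ 2) + (1 - a * b * X ^ 2) * (c * Y))

/-- Put S = abX², U = cdY², and let T_k be the inner sum over q ≤ 2k. Pairing p = 2k + 1 with p = 2k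
+ 2 leaves ∑ S^k T_k and ∑ (SU)^k. As T_{k+1} - T_k = z(cY + cdY²)U^k, summation by parts gives the
denominators 1 - S and 1 - SU, and no 1 - U. The remainder is a multiple of S^k. -/
theorem mul_doubleSum (a b c d z X Y : R) (k : ℕ) :
    (1 - a * b * X ^ 2) * (1 - a * b * c * d * X ^ 2 * Y ^ 2) *
        doubleSum (partWeight a b z) (partWeight c d z) X Y (2 * k) =
      doubleSumNum a b c d z X Y + (a * b * X ^ 2) ^ k *
        -((1 - a * b * c * d * X ^ 2 * Y ^ 2) * (a * X + a * b * X ^ 2) * z *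
            (∑ q ∈ Finset.range (2 * k + 1), partWeight c d z q * Y ^ q) +
          z ^ 2 * (a * b * X ^ 2) * ((a * X + a * b * X ^ 2) * (c * Y + c * d * Y ^ 2) +
            (1 - a * b * X ^ 2) * (c * Y)) * (c * d * Y ^ 2) ^ k) := by
  induction k with
  | zero =>
    simp [doubleSum, doubleSumNum, partWeight_zero]
    ring
  | succ k ih =>
    have hd : doubleSum (partWeight a b z) (partWeight c d z) X Y (2 * (k + 1)) =
        doubleSum (partWeight a b z) (partWeight c d z) X Y (2 * k) +
          partWeight a b z (2 * k + 1) * X ^ (2 * k + 1) *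
            (∑ q ∈ Finset.range (2 * k + 1), partWeight c d z q * Y ^ q) +
          partWeight a b z (2 * k + 2) * X ^ (2 * k + 2) *
            (∑ q ∈ Finset.range (2 * k + 1), partWeight c d z q * Y ^ q +
              partWeight c d z (2 * k + 1) * Y ^ (2 * k + 1)) := by
      unfold doubleSum
      rw [show 2 * (k + 1) = 2 * k + 1 + 1 by ring, Finset.sum_range_succ, Finset.sum_range_succ,
        Finset.sum_range_succ (fun q => partWeight c d z q * Y ^ q) (2 * k + 1)]
    rw [hd, mul_add, mul_add, ih, show 2 * (k + 1) + 1 = 2 * k + 1 + 1 + 1 by ring,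
      Finset.sum_range_succ _ (2 * k + 1 + 1), Finset.sum_range_succ _ (2 * k + 1),
      partWeight_odd, partWeight_even, partWeight_odd, partWeight_even]
    generalize ∑ q ∈ Finset.range (2 * k + 1), partWeight c d z q * Y ^ q = T
    have e1 : z * (a ^ (k + 1) * b ^ k) * X ^ (2 * k + 1) = z * (a * X) * (a * b * X ^ 2) ^ k := by
      ring
    have e2 : z * (a ^ (k + 1) * b ^ (k + 1)) * X ^ (2 * k + 2) =
      z * (a * b * X ^ 2) * (a * b * X ^ 2) ^ k := by ring
    have e3 : z * (c ^ (k + 1) * d ^ k) * Y ^ (2 * k + 1) = z * (c * Y) * (c * d * Y ^ 2) ^ k := by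
      ring
    have e4 : z * (c ^ (k + 1) * d ^ (k + 1)) * Y ^ (2 * k + 1 + 1) =
      z * (c * d * Y ^ 2) * (c * d * Y ^ 2) ^ k := by ring
    rw [e1, e2, e3, e4, pow_succ (a * b * X ^ 2) k, pow_succ (c * d * Y ^ 2) k]
    generalize (a * b * X ^ 2) ^ k = S
    generalize (c * d * Y ^ 2) ^ k = U
    ring

end Weights

/-! ### Identities between the entries of the Pfaffians. -/

section Algebra

open MvPowerSeries

variable {σ K : Type*} [Field K] {n : ℕ} {a b c d : MvPowerSeries σ K}

theorem le_order_pow_mul {s : MvPowerSeries σ K} (hs : constantCoeff s = 0) (k : ℕ)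
    (f : MvPowerSeries σ K) : k + f.order ≤ (s ^ k * f).order :=
  (add_le_add_left (le_order_pow_of_constantCoeff_eq_zero k hs) _).trans le_order_mul

theorem zetaN_eq (z : MvPowerSeries σ K) (x : Fin n → K) (N : ℕ) : zetaN a b c d z x N =
    (∑ μ ∈ StrictPartition.bounded N, alternatingWeight (partWeight a b z) (partWeight c d z)
      μ.parts * C (pfMu x μ)) * (C (pfMu x StrictPartition.empty))⁻¹ := by
  rw [zetaN, Finset.sum_mul]
  refine Finset.sum_congr rfl fun μ _ => ?_
  rw [zetaTerm, weight_mul_pow_length, schurP, div_eq_mul_inv, map_mul, C_inv, mul_assoc]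

theorem uEntry_mul (ha : constantCoeff a = 0) (x : Fin n → MvPowerSeries σ K) (i j : Fin n) :
    uEntry a b x i j * ((1 - a * b * x i ^ 2) * (1 - a * b * x j ^ 2)) =
      a * ((x i + b * x i ^ 2) * (1 - a * b * x j ^ 2) -
        (1 - a * b * x i ^ 2) * (x j + b * x j ^ 2)) := by
  rw [uEntry, Matrix.det_fin_two_of, mul_assoc, MvPowerSeries.inv_mul_cancel _ (by simp [ha]),
    mul_one]

theorem vEntry_mul (ha : constantCoeff a = 0) (x : Fin n → MvPowerSeries σ K) (i j : Fin n) :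
    vEntry a b c d x i j * ((1 - a * b * x i ^ 2) * (1 - a * b * x j ^ 2) *
      (1 - a * b * c * d * x i ^ 2 * x j ^ 2)) = a * b * c * x i * x j *
        ((x i + a * x i ^ 2) * (1 - a * (b + d) * x j ^ 2 - a * b * d * x j ^ 3) -
          (1 - a * (b + d) * x i ^ 2 - a * b * d * x i ^ 3) * (x j + a * x j ^ 2)) := by
  rw [vEntry, Matrix.det_fin_two_of, mul_assoc _ _⁻¹,
    MvPowerSeries.inv_mul_cancel _ (by simp [ha]), mul_one]

theorem vTildeEntry_mul (ha : constantCoeff a = 0) (x : Fin n → MvPowerSeries σ K) (i j : Fin n) :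
    vTildeEntry a b c d x i j * ((1 - a * b * x i ^ 2) * (1 - a * b * x j ^ 2) *
      (1 - a * b * c * d * x i ^ 2 * x j ^ 2)) = a *
        ((x i + b * x i ^ 2) * (1 - b * (a + c) * x j ^ 2 - a * b * c * x j ^ 3) -
          (1 - b * (a + c) * x i ^ 2 - a * b * c * x i ^ 3) * (x j + b * x j ^ 2)) := by
  rw [vTildeEntry, Matrix.det_fin_two_of, mul_assoc _ _⁻¹,
    MvPowerSeries.inv_mul_cancel _ (by simp [ha]), mul_one]

theorem entry_denominator_ne_zero (ha : constantCoeff a = 0) (x : Fin n → MvPowerSeries σ K)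
    (i j : Fin n) : (1 - a * b * x i ^ 2) * (1 - a * b * x j ^ 2) *
      (1 - a * b * c * d * x i ^ 2 * x j ^ 2) ≠ 0 := fun h => by
  have := congrArg constantCoeff h
  simp [ha] at this

/-- The antisymmetrized limit of the double sums is the correction to (x_i - x_j)/(x_i + x_j) in
γ_ij. Clearing the common denominator, which has constant coefficient 1, leaves a polynomial
identity. -/
theorem doubleSum_limit_sub (ha : constantCoeff a = 0) (z : MvPowerSeries σ K)
    (x : Fin n → MvPowerSeries σ K) (i j : Fin n) :
    doubleSumNum a b c d z (x i) (x j) *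
        ((1 - a * b * x i ^ 2) * (1 - a * b * c * d * x i ^ 2 * x j ^ 2))⁻¹ -
      doubleSumNum a b c d z (x j) (x i) *
        ((1 - a * b * x j ^ 2) * (1 - a * b * c * d * x j ^ 2 * x i ^ 2))⁻¹ =
      uEntry a b x i j * z + vEntry a b c d x i j * z ^ 2 := by
  refine mul_right_cancel₀ (entry_denominator_ne_zero (b := b) (c := c) (d := d) ha x i j) ?_
  have h : ∀ i j, doubleSumNum a b c d z (x i) (x j) *
      ((1 - a * b * x i ^ 2) * (1 - a * b * c * d * x i ^ 2 * x j ^ 2))⁻¹ *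
        ((1 - a * b * x i ^ 2) * (1 - a * b * c * d * x i ^ 2 * x j ^ 2)) =
      doubleSumNum a b c d z (x i) (x j) := fun i j => by
    rw [mul_assoc, MvPowerSeries.inv_mul_cancel _ (by simp [ha]), mul_one]
  have h1 := h i j
  have h2 := h j i
  have hu := uEntry_mul (b := b) ha x i j
  have hv := vEntry_mul (b := b) (c := c) (d := d) ha x i j
  rw [doubleSumNum] at h1 h2 ⊢
  rw [doubleSumNum]
  linear_combination (1 - a * b * x j ^ 2) * h1 - (1 - a * b * x i ^ 2) * h2 -
    z * (1 - a * b * c * d * x i ^ 2 * x j ^ 2) * hu - z ^ 2 * hv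

theorem uEntry_add_vEntry (ha : constantCoeff a = 0) (x : Fin n → MvPowerSeries σ K)
    (i j : Fin n) : uEntry a b x i j + vEntry a b c d x i j = vTildeEntry a b c d x i j := by
  refine mul_right_cancel₀ (entry_denominator_ne_zero (b := b) (c := c) (d := d) ha x i j) ?_
  linear_combination (1 - a * b * c * d * x i ^ 2 * x j ^ 2) * uEntry_mul (b := b) ha x i j +
    vEntry_mul (b := b) (c := c) (d := d) ha x i j -
    vTildeEntry_mul (b := b) (c := c) (d := d) ha x i j

theorem gamma_one (ha : constantCoeff a = 0) (x : Fin n → MvPowerSeries σ K) :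
    gamma a b c d 1 x = gammaTilde a b c d x := by
  ext1 i j
  simp only [gamma, gammaTilde, Matrix.of_apply, ← uEntry_add_vEntry ha, mul_one, one_pow,
    add_assoc]

theorem gammaZero_one (ha : constantCoeff a = 0) (x : Fin n → MvPowerSeries σ K) :
    gammaZero a b 1 x = gammaTildeZero a b x := by
  funext j
  have hj : constantCoeff (1 - a * b * x j ^ 2) ≠ 0 := by simp [ha]
  rw [gammaZero, gammaTildeZero]
  linear_combination -MvPowerSeries.mul_inv_cancel _ hj

end Algebra

/-! ### Convergence and passage to the limit. -/

section Limits

open MvPowerSeries Filter Topology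

variable {σ K : Type*} [Field K] [TopologicalSpace K]

/-- The order of `s ^ k * f k` is at least k whatever `f k` is, so each coefficient is eventually 0.
-/
theorem tendsto_pow_mul {s : MvPowerSeries σ K} (hs : constantCoeff s = 0)
    (f : ℕ → MvPowerSeries σ K) : Tendsto (fun k => s ^ k * f k) atTop (𝓝 0) := by
  rw [WithPiTopology.tendsto_iff_coeff_tendsto]
  intro e
  refine tendsto_const_nhds.congr' ?_
  filter_upwards [eventually_gt_atTop e.degree] with k hk
  refine (coeff_of_lt_order ?_).symm
  exact (Nat.cast_lt.2 hk).trans_le (le_self_add.trans (le_order_pow_mul hs k (f k)))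

theorem tendsto_of_mul_eq_add_pow_mul [DiscreteTopology K] {s D P : MvPowerSeries σ K} (hs : constantCoeff s = 0)
    (hD : constantCoeff D ≠ 0) (f g : ℕ → MvPowerSeries σ K)
    (h : ∀ k, D * f k = P + s ^ k * g k) : Tendsto f atTop (𝓝 (P * D⁻¹)) := by
  have hf : f = fun k => P * D⁻¹ + s ^ k * (g k * D⁻¹) := by
    funext k
    rw [← mul_assoc, ← add_mul, ← h, mul_comm D, mul_assoc, MvPowerSeries.mul_inv_cancel D hD,
      mul_one]
  rw [hf]
  simpa using (tendsto_pow_mul hs fun k => g k * D⁻¹).const_add (P * D⁻¹)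

theorem continuous_pfaffian {m : ℕ} {R : Type*} [CommRing R] [TopologicalSpace R]
    [IsTopologicalRing R] : Continuous (pfaffian : Matrix (Fin m) (Fin m) R → R) := by
  unfold pfaffian
  split_ifs
  · refine continuous_finsetSum _ fun τ _ => continuous_const.mul ?_
    exact continuous_finsetProd _ fun i _ => continuous_id.matrix_elem _ _
  · exact continuous_const

variable {n : ℕ} {a b c d : MvPowerSeries σ K}

/-- The exponents in ω(μ) add up to |μ|, which bounds every part; only finitely many μ thus
contribute to a given coefficient. -/
theorem summable_zetaTerm (ha : constantCoeff a = 0) (hb : constantCoeff b = 0)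
    (hc : constantCoeff c = 0) (hd : constantCoeff d = 0) (z : MvPowerSeries σ K) (x : Fin n → K) :
    Summable (zetaTerm a b c d z x) := by
  rw [WithPiTopology.summable_iff_summable_coeff]
  intro e
  refine summable_of_hasFiniteSupport ((StrictPartition.finite_bounded e.degree).subset fun μ hμ => ?_)
  intro p hp
  by_contra hlt
  rw [not_le] at hlt
  refine hμ (coeff_of_lt_order ((Nat.cast_lt.2 hlt).trans_le ?_))
  rw [zetaTerm, StrictPartition.weight]
  simp only [mul_assoc]
  set A := ∑ i ∈ Finset.range μ.length with Even i, (μ.part i + 1) / 2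
  set B := ∑ i ∈ Finset.range μ.length with Even i, μ.part i / 2
  set C' := ∑ i ∈ Finset.range μ.length with Odd i, (μ.part i + 1) / 2
  set D := ∑ i ∈ Finset.range μ.length with Odd i, μ.part i / 2
  -- A single part p already contributes ⌈p/2⌉ + ⌊p/2⌋ = p to the exponents.
  have hsum : p ≤ A + (B + (C' + D)) := by
    obtain ⟨i, hi, rfl⟩ := List.getElem_of_mem hp
    have hpi : μ.part i = μ.parts[i] := List.getD_eq_getElem _ _ hi
    rcases Nat.even_or_odd i with hi' | hi'
    · have hm : i ∈ (Finset.range μ.length).filter Even := by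
        simpa [hi', StrictPartition.length] using hi
      have h1 : (μ.part i + 1) / 2 ≤ A :=
        Finset.single_le_sum (f := fun i => (μ.part i + 1) / 2) (fun _ _ => Nat.zero_le _) hm
      have h2 : μ.part i / 2 ≤ B :=
        Finset.single_le_sum (f := fun i => μ.part i / 2) (fun _ _ => Nat.zero_le _) hm
      omega
    · have hm : i ∈ (Finset.range μ.length).filter Odd := by
        simpa [hi', StrictPartition.length] using hi
      have h1 : (μ.part i + 1) / 2 ≤ C' :=
        Finset.single_le_sum (f := fun i => (μ.part i + 1) / 2) (fun _ _ => Nat.zero_le _) hm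
      have h2 : μ.part i / 2 ≤ D :=
        Finset.single_le_sum (f := fun i => μ.part i / 2) (fun _ _ => Nat.zero_le _) hm
      omega
  calc (p : ℕ∞) ≤ A + (B + (C' + D)) := by exact_mod_cast hsum
    _ ≤ _ := le_trans ?_ (le_order_pow_mul ha _ _)
  gcongr
  refine le_trans ?_ (le_order_pow_mul hb _ _)
  gcongr
  refine le_trans ?_ (le_order_pow_mul hc _ _)
  gcongr
  exact le_self_add.trans (le_order_pow_mul hd _ _)

theorem tendsto_zetaN (ha : constantCoeff a = 0) (hb : constantCoeff b = 0)
    (hc : constantCoeff c = 0) (hd : constantCoeff d = 0) (z : MvPowerSeries σ K) (x : Fin n → K) :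
    Tendsto (zetaN a b c d z x) atTop (𝓝 (zeta a b c d z x)) := by
  refine (summable_zetaTerm ha hb hc hd z x).hasSum.comp ?_
  refine tendsto_atTop_finset_of_monotone (fun M N h μ hμ => ?_) fun μ => ⟨μ.parts.sum, ?_⟩
  · exact StrictPartition.mem_bounded.2 fun p hp => (StrictPartition.mem_bounded.1 hμ p hp).trans h
  · exact StrictPartition.mem_bounded.2 fun p hp => List.le_sum_of_mem hp

theorem tendsto_doubleSum [DiscreteTopology K] (ha : constantCoeff a = 0) (z X Y : MvPowerSeries σ K) :
    Tendsto (fun k => doubleSum (partWeight a b z) (partWeight c d z) X Y (2 * k)) atTop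
      (𝓝 (doubleSumNum a b c d z X Y *
        ((1 - a * b * X ^ 2) * (1 - a * b * c * d * X ^ 2 * Y ^ 2))⁻¹)) :=
  tendsto_of_mul_eq_add_pow_mul (s := a * b * X ^ 2) (by simp [ha]) (by simp [ha]) _ _
    fun k => mul_doubleSum a b c d z X Y k

theorem tendsto_gammaZero [DiscreteTopology K] (ha : constantCoeff a = 0) (z : MvPowerSeries σ K)
    (x : Fin n → MvPowerSeries σ K) (j : Fin n) :
    Tendsto (fun k => ∑ p ∈ Finset.range (2 * k + 1), partWeight a b z p * x j ^ p) atTop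
      (𝓝 (gammaZero a b z x j)) := by
  have hD : constantCoeff (1 - a * b * x j ^ 2) ≠ 0 := by simp [ha]
  have h := tendsto_of_mul_eq_add_pow_mul (s := a * b * x j ^ 2) (by simp [ha]) hD _ _
    fun k => one_sub_mul_sum_range_partWeight a b z (x j) k
  convert h using 2
  rw [gammaZero]
  linear_combination -MvPowerSeries.mul_inv_cancel _ hD

theorem tendsto_gamma [DiscreteTopology K] (ha : constantCoeff a = 0) (z : MvPowerSeries σ K)
    (x : Fin n → K) :
    Tendsto (fun k => Matrix.of fun i j => C (schurMatrix x i j) +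
      (doubleSum (partWeight a b z) (partWeight c d z) (C (x i)) (C (x j)) (2 * k) -
        doubleSum (partWeight a b z) (partWeight c d z) (C (x j)) (C (x i)) (2 * k))) atTop
      (𝓝 (gamma a b c d z fun i => C (x i))) := by
  refine tendsto_pi_nhds.2 fun i => tendsto_pi_nhds.2 fun j => ?_
  by_cases hij : i = j
  · subst hij
    simp [gamma, schurMatrix_self]
  · have h := ((tendsto_doubleSum (b := b) (c := c) (d := d) ha z (C (x i)) (C (x j))).sub
      (tendsto_doubleSum (b := b) (c := c) (d := d) ha z (C (x j)) (C (x i)))).const_add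
        (C (schurMatrix x i j))
    rw [doubleSum_limit_sub ha z (fun i => C (x i))] at h
    simpa [gamma, schurMatrix, hij, div_eq_mul_inv, C_inv, ← add_assoc, ← map_add] using h

theorem zeta_eq [DiscreteTopology K] (ha : constantCoeff a = 0) (hb : constantCoeff b = 0)
    (hc : constantCoeff c = 0) (hd : constantCoeff d = 0) (z : MvPowerSeries σ K) (x : Fin n → K)
    (hx : ∀ i, x i ≠ 0) :
    (Even n → zeta a b c d z x = pfaffian (gamma a b c d z fun i => C (x i)) *
      (C (pfMu x StrictPartition.empty))⁻¹) ∧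
    (Odd n → zeta a b c d z x = pfaffian (bordered (gammaZero a b z fun i => C (x i))
      (gamma a b c d z fun i => C (x i))) * (C (pfMu x StrictPartition.empty))⁻¹) := by
  -- Convergence is already known, so the limit may be computed along even N, where the closed forms
  -- hold.
  have hz : Tendsto (fun k => zetaN a b c d z x (2 * k)) atTop (𝓝 (zeta a b c d z x)) :=
    (tendsto_zetaN ha hb hc hd z x).comp (tendsto_id.const_mul_atTop' two_pos)
  have hN := fun N => sum_bounded_alternatingWeight_mul_pfMu (C (σ := σ)) x hx (partWeight a b z)
    (partWeight c d z) (partWeight_zero _ _ _) (partWeight_zero _ _ _) N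
  have hg := tendsto_gamma (b := b) (c := c) (d := d) ha z x
  constructor
  · intro hn
    simp_rw [zetaN_eq, (hN _).1 hn] at hz
    exact tendsto_nhds_unique hz (((continuous_pfaffian.tendsto _).comp hg).mul_const _)
  · intro hn
    simp_rw [zetaN_eq, (hN _).2 hn] at hz
    refine tendsto_nhds_unique hz (((continuous_pfaffian.tendsto _).comp ?_).mul_const _)
    refine tendsto_pi_nhds.2 fun i => tendsto_pi_nhds.2 fun j => ?_
    have hr := fun j => tendsto_gammaZero (b := b) ha z (fun i => C (x i)) j
    refine Fin.cases (Fin.cases tendsto_const_nhds (fun j => hr j) j) (fun i => ?_) i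
    refine Fin.cases (hr i).neg (fun j => ?_) j
    exact tendsto_pi_nhds.1 (tendsto_pi_nhds.1 hg i) j

end Limits

end SchurP

theorem mainTheorem10 (n : ℕ) (hn : 0 < n) :
    let a : SchurP.Series n := MvPowerSeries.X 0
    let b : SchurP.Series n := MvPowerSeries.X 1
    let c : SchurP.Series n := MvPowerSeries.X 2
    let d : SchurP.Series n := MvPowerSeries.X 3
    let z : SchurP.Series n := MvPowerSeries.X 4
    let X : Fin n → SchurP.RatFun n := SchurP.xvar n
    let x : Fin n → SchurP.Series n := SchurP.xser n
    (Summable (SchurP.zetaTerm a b c d z X) ∧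
        Filter.Tendsto (SchurP.zetaN a b c d z X) Filter.atTop
          (nhds (SchurP.zeta a b c d z X)) ∧
        (Even n → SchurP.zeta a b c d z X =
          SchurP.pfaffian (SchurP.gamma a b c d z x) *
            (SchurP.pfEmpty n)⁻¹) ∧
        (Odd n → SchurP.zeta a b c d z X =
          SchurP.pfaffian (SchurP.bordered (SchurP.gammaZero a b z x)
              (SchurP.gamma a b c d z x)) *
            (SchurP.pfEmpty n)⁻¹)) ∧
    (Summable (SchurP.zetaTerm a b c d 1 X) ∧
        Filter.Tendsto (SchurP.zetaN a b c d 1 X) Filter.atTop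
          (nhds (SchurP.xi a b c d X)) ∧
        (Even n → SchurP.xi a b c d X =
          SchurP.pfaffian (SchurP.gammaTilde a b c d x) *
            (SchurP.pfEmpty n)⁻¹) ∧
        (Odd n → SchurP.xi a b c d X =
          SchurP.pfaffian (SchurP.bordered (SchurP.gammaTildeZero a b x)
              (SchurP.gammaTilde a b c d x)) *
            (SchurP.pfEmpty n)⁻¹)) := by
  intro a b c d z X x
  have ha : MvPowerSeries.constantCoeff a = 0 := MvPowerSeries.constantCoeff_X 0
  have hb : MvPowerSeries.constantCoeff b = 0 := MvPowerSeries.constantCoeff_X 1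
  have hc : MvPowerSeries.constantCoeff c = 0 := MvPowerSeries.constantCoeff_X 2
  have hd : MvPowerSeries.constantCoeff d = 0 := MvPowerSeries.constantCoeff_X 3
  have hX : ∀ i, X i ≠ 0 := fun i h => MvPolynomial.X_ne_zero (R := ℚ) i
    (IsFractionRing.injective (MvPolynomial (Fin n) ℚ) (SchurP.RatFun n) (h.trans (map_zero _).symm))
  have h1 := SchurP.zeta_eq ha hb hc hd 1 X hX
  rw [SchurP.gamma_one ha, SchurP.gammaZero_one ha] at h1
  exact ⟨⟨SchurP.summable_zetaTerm ha hb hc hd z X, SchurP.tendsto_zetaN ha hb hc hd z X,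
    SchurP.zeta_eq ha hb hc hd z X hX⟩, SchurP.summable_zetaTerm ha hb hc hd 1 X,
    SchurP.tendsto_zetaN ha hb hc hd 1 X, h1⟩
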